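/- **Definitions.** A family in a set $X$ is a countable indexed multiset $\{x_i\}_{i\in I}$, considered up to bijections of the index set; $X^*$ is the set of families. A *weak $\Sigma$-monoid* is a set $X$ with a partial function $\Sigma\colon X^*\rightharpoonup X$ such that (singleton) $\Sigma\{x\}=x$; (neutral element) $\Sigma\emptyset=0$ is defined, and if a family is summable (i.e. $\Sigma$ is defined on it) then so is its subfamily of elements $\neq 0$; (bracketing) if $\mathbf{x}=\biguplus_{j\in J}\mathbf{x}_j$ with every $\mathbf{x}_j$ finite and summable, and $\Sigma\mathbf{x}=x$, then $\Sigma\{\Sigma\mathbf{x}_j\}_J=x$; (flattening) if $\mathbf{x}=\biguplus_{j\in J}\mathbf{x}_j$ with $J$ finite and every $\mathbf{x}_j$ summable, and $\Sigma\{\Sigma\mathbf{x}_j\}_J=x$, then $\Sigma\mathbf{x}=x$. A *$\Sigma$-homomorphism* is a function $f$ such that $\Sigma\mathbf{x}=x$ implies $\Sigma f\mathbf{x}=f(x)$. A weak $\Sigma$-monoid is *strong* if subfamilies of summable families are summable, and bracketing and flattening hold for arbitrary countable $J$ and arbitrary summable $\mathbf{x}_j$; it is *finitely total* if every finite family is summable;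 a *$\Sigma$-group* is a finitely total $\Sigma$-monoid in which every $x$ has an element $-x$ with $\Sigma\{x,-x\}=0$ such that $x\mapsto -x$ is a $\Sigma$-homomorphism. Let $\mathbf{SCat}_w$ be the category of weak $\Sigma$-monoids and $\Sigma$-homomorphisms, and $\mathbf{SCat}_s,\mathbf{SCat}_{ft},\mathbf{SCat}_g$ its full subcategories of strong $\Sigma$-monoids, finitely total $\Sigma$-monoids and $\Sigma$-groups; $\mathbf{SCat}_*$ denotes any of the four. The embeddings are $\mathbf{SCat}_s\hookrightarrow\mathbf{SCat}_w$ and $\mathbf{SCat}_g\hookrightarrow\mathbf{SCat}_{ft}\hookrightarrow\mathbf{SCat}_w$, their composites and the identities. A function $X\times Y\to Z$ between objects of $\mathbf{SCat}_*$ is *$\Sigma$-bilinear* if it is a $\Sigma$-homomorphism in each variable separately; a *tensor product* of $X$ and $Y$ in $\mathbf{SCat}_*$ is an object with a $\Sigma$-bilinear function $p$ from $X\times Y$ to it through which every $\Sigma$-bilinear function from $X\times Y$ to an object of $\mathbf{SCat}_*$ factors by a unique $\Sigma$-homomorphism. Let $I=\{0,1\}\in\mathbf{SCat}_w$, where the sum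 of a family is $0$ if it contains no $1$, is $1$ if it contains exactly one $1$, and is undefined otherwise. **Theorem.** Every embedding between $\mathbf{SCat}_*$ categories has a left adjoint. There are symmetric monoidal structures on the four categories $\mathbf{SCat}_*$ such that: 1. The monoidal product of $X,Y\in\mathbf{SCat}_*$ is the tensor product of $X$ and $Y$ in $\mathbf{SCat}_*$. Its action on morphisms, the associator, the unitors and the braiding are the liftings of those of the cartesian product of sets: $(f\otimes g)(p(x,y))=p(f(x),g(y))$, $\alpha(p(p(x,y),z))=p(x,p(y,z))$, $\lambda(p(1,x))=x=\rho(p(x,1))$ and $\beta(p(x,y))=p(y,x)$, where $1$ is a chosen element of the monoidal unit. 2. Each of the four symmetric monoidal categories is closed. 3. The monoidal unit of $\mathbf{SCat}_w$ is $I$, with chosen element $1$. If $U\colon\mathbf{SCat}_*\hookrightarrow\mathbf{SCat}_w$ is the embedding, $F$ is any left adjoint of it, and $\eta$ is the unit of the adjunction, then the monoidal product of $\mathbf{SCat}_*$ is $X\otimes' Y\cong F(UX\otimes UY)$ with universal $\Sigma$-bilinear function $\eta\circ p$, where $\otimes$ and $p$ are those of $\mathbf{SCat}_w$; and the monoidal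 unit of $\mathbf{SCat}_*$ is $F(I)$ up to an isomorphism matching the chosen element with $\eta(1)$. 4. Every left adjoint $F$ of an embedding between $\mathbf{SCat}_*$ categories is strong symmetric monoidal, through the canonical isomorphisms $F(X)\otimes F(Y)\cong F(X\otimes Y)$, $p(\eta(x),\eta(y))\mapsto\eta(p(x,y))$, and the isomorphism of monoidal units sending the chosen element $1$ to $\eta(1)$. -/

import Mathlib

universe u v w

open CategoryTheory MonoidalCategory

/-! ### Families -/

/-- Two families of elements of `X`, indexed by subsets of the infinite set `ℕ`, are the same when
a bijection of the indexing sets identifies them. -/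
def familySetoid (X : Type u) : Setoid (Σ I : Set ℕ, I → X) where
  r a b := ∃ φ : a.1 ≃ b.1, ∀ i, a.2 i = b.2 (φ i)
  iseqv :=
    { refl := fun _ => ⟨Equiv.refl _, fun _ => rfl⟩
      symm := fun ⟨φ, h⟩ => ⟨φ.symm, fun i => by simp [h]⟩
      trans := fun ⟨φ, h⟩ ⟨ψ, k⟩ => ⟨φ.trans ψ, fun i => by simp [h, k]⟩ }

/-- The set `X^*` of families (countable indexed multisets) of elements of `X`, the indexing sets
being subsets of `ℕ`. -/
def Family (X : Type u) : Type u := Quotient (familySetoid X)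

namespace Family

variable {X : Type u} {Y : Type v}

/-- The family `{x i}_{i : ι}` for an arbitrary countable type `ι`. -/
noncomputable def of {ι : Type w} [Countable ι] (x : ι → X) : Family X :=
  Quotient.mk (familySetoid X)
    ⟨Set.range (exists_injective_nat ι).choose,
      fun i => x ((Equiv.ofInjective _ (exists_injective_nat ι).choose_spec).symm i)⟩

/-- The family `f 𝐱` obtained by applying `f` to each element of `𝐱`. -/
def map (f : X → Y) : Family X → Family Y :=
  Quotient.map (fun a => ⟨a.1, fun i => f (a.2 i)⟩)
    (fun _ _ ⟨φ, h⟩ => ⟨φ, fun i => congrArg f (h i)⟩)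

theorem of_eq_of_iff {ι : Type w} [Countable ι] {κ : Type v} [Countable κ] {x : ι → X}
    {y : κ → X} : of x = of y ↔ ∃ φ : ι ≃ κ, ∀ i, x i = y (φ i) := by
  set e := Equiv.ofInjective _ (exists_injective_nat ι).choose_spec
  set d := Equiv.ofInjective _ (exists_injective_nat κ).choose_spec
  constructor
  · intro h
    obtain ⟨φ, hφ⟩ := Quotient.exact h
    refine ⟨(e.trans φ).trans d.symm, fun i => ?_⟩
    have := hφ (e i)
    simpa [e, d] using this
  · rintro ⟨φ, hφ⟩
    refine Quotient.sound ⟨(e.symm.trans φ).trans d, fun i => ?_⟩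
    change x (e.symm i) = y (d.symm (((e.symm.trans φ).trans d) i))
    simp [hφ]

theorem mk_eq_of (I : Set ℕ) (x : I → X) :
    (Quotient.mk (familySetoid X) ⟨I, x⟩ : Family X) = of x := by
  set e := Equiv.ofInjective _ (exists_injective_nat I).choose_spec
  refine Quotient.sound ⟨e, fun i => ?_⟩
  change x i = x (e.symm (e i))
  simp

theorem exists_of (s : Family X) : ∃ (I : Set ℕ) (x : I → X), s = of x := by
  induction s using Quotient.inductionOn with
  | h a => exact ⟨a.1, a.2, mk_eq_of a.1 a.2⟩

theorem map_of {ι : Type w} [Countable ι] (f : X → Y) (x : ι → X) :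
    map f (of x) = of (fun i => f (x i)) := rfl

theorem map_id' (s : Family X) : map (fun x => x) s = s := by
  obtain ⟨I, x, rfl⟩ := exists_of s
  rfl

theorem map_map {Z : Type w} (g : Y → Z) (f : X → Y) (s : Family X) :
    map g (map f s) = map (fun x => g (f x)) s := by
  obtain ⟨I, x, rfl⟩ := exists_of s
  rfl

/-- The empty family. -/
noncomputable def empty : Family X := of (fun i : Empty => i.elim)

/-- The family `{x}`. -/
noncomputable def single (x : X) : Family X := of (fun _ : Unit => x)

/-- The family `{x, y}`. -/
noncomputable def pair (x y : X) : Family X := of (fun b : Bool => cond b x y)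

end Family

/-! ### Weak `Σ`-monoids -/

/-- A weak `Σ`-monoid: a set with a partial function `Σ : X^* ⇀ X`. The statement `a ∈ sum 𝐱`
says that `Σ 𝐱` is defined and equal to `a`. -/
structure WeakSigmaMonoid where
  carrier : Type u
  sum : Family carrier → Part carrier
  sum_single : ∀ x, x ∈ sum (Family.single x)
  neutral : ∃ z, z ∈ sum Family.empty ∧
    ∀ {I : Type} [Countable I] (x : I → carrier), (sum (Family.of x)).Dom →
      (sum (Family.of (fun i : {i // x i ≠ z} => x i))).Dom
  bracketing : ∀ {J : Type} [Countable J] {K : J → Type} [∀ j, Finite (K j)]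
    (x : ∀ j, K j → carrier) (s : J → carrier), (∀ j, s j ∈ sum (Family.of (x j))) →
    ∀ a, a ∈ sum (Family.of (fun q : Σ j, K j => x q.1 q.2)) → a ∈ sum (Family.of s)
  flattening : ∀ {J : Type} [Finite J] {K : J → Type} [∀ j, Countable (K j)]
    (x : ∀ j, K j → carrier) (s : J → carrier), (∀ j, s j ∈ sum (Family.of (x j))) →
    ∀ a, a ∈ sum (Family.of s) → a ∈ sum (Family.of (fun q : Σ j, K j => x q.1 q.2))

namespace WeakSigmaMonoid

/-- The neutral element `0 = Σ ∅`. -/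
noncomputable def zero (X : WeakSigmaMonoid.{u}) : X.carrier := X.neutral.choose

theorem zero_mem (X : WeakSigmaMonoid.{u}) : X.zero ∈ X.sum Family.empty :=
  X.neutral.choose_spec.1

/-- `f : X → Y` is a `Σ`-homomorphism. -/
def IsHom (X Y : WeakSigmaMonoid.{u}) (f : X.carrier → Y.carrier) : Prop :=
  ∀ (s : Family X.carrier) (x : X.carrier), x ∈ X.sum s → f x ∈ Y.sum (s.map f)

/-- The type of `Σ`-homomorphisms. -/
@[ext]
structure Hom (X Y : WeakSigmaMonoid.{u}) where
  toFun : X.carrier → Y.carrier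
  isHom : IsHom X Y toFun

/-- The category of weak `Σ`-monoids and `Σ`-homomorphisms. -/
instance : Category WeakSigmaMonoid.{u} where
  Hom := Hom
  id X := ⟨fun x => x, fun s x h => by rwa [Family.map_id']⟩
  comp f g := ⟨fun x => g.toFun (f.toFun x), fun s x h => by
    rw [← Family.map_map]
    exact g.isHom _ _ (f.isHom _ _ h)⟩

/-- Strong `Σ`-monoids. -/
structure IsStrong (X : WeakSigmaMonoid.{u}) : Prop where
  subsummability : ∀ {I : Type} [Countable I] (x : I → X.carrier), (X.sum (Family.of x)).Dom →
    ∀ S : Set I, (X.sum (Family.of (fun i : S => x i))).Dom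
  strong_bracketing : ∀ {J : Type} [Countable J] {K : J → Type} [∀ j, Countable (K j)]
    (x : ∀ j, K j → X.carrier) (s : J → X.carrier), (∀ j, s j ∈ X.sum (Family.of (x j))) →
    ∀ a, a ∈ X.sum (Family.of (fun q : Σ j, K j => x q.1 q.2)) → a ∈ X.sum (Family.of s)
  strong_flattening : ∀ {J : Type} [Countable J] {K : J → Type} [∀ j, Countable (K j)]
    (x : ∀ j, K j → X.carrier) (s : J → X.carrier), (∀ j, s j ∈ X.sum (Family.of (x j))) →
    ∀ a, a ∈ X.sum (Family.of s) → a ∈ X.sum (Family.of (fun q : Σ j, K j => x q.1 q.2))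

/-- Finitely total `Σ`-monoids: every finite family is summable. -/
def IsFinitelyTotal (X : WeakSigmaMonoid.{u}) : Prop :=
  ∀ {I : Type} [Finite I] (x : I → X.carrier), (X.sum (Family.of x)).Dom

/-- `Σ`-groups. -/
def IsSigmaGroup (X : WeakSigmaMonoid.{u}) : Prop :=
  X.IsFinitelyTotal ∧ ∃ neg : X.carrier → X.carrier,
    (∀ x, X.zero ∈ X.sum (Family.pair x (neg x))) ∧ IsHom X X neg

/-! ### The monoidal unit -/

section Unit

open Classical in
/-- The partial sum on `{0, 1}`: the sum is `0` if there is no `1` in the family, it is `1` if there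
is exactly one, and it is undefined otherwise. -/
noncomputable def unitSum : Family (ULift.{u} (Fin 2)) → Part (ULift.{u} (Fin 2)) :=
  Quotient.lift
    (fun a : Σ I : Set ℕ, I → ULift.{u} (Fin 2) =>
      if ¬ ∃ j, a.2 j = ⟨1⟩ then Part.some ⟨0⟩
      else if ∃! j, a.2 j = ⟨1⟩ then Part.some ⟨1⟩
      else Part.none)
    (by
      rintro a b ⟨φ, h⟩
      have h1 : (∃ j, a.2 j = ⟨1⟩) ↔ ∃ j, b.2 j = ⟨1⟩ := by
        simp only [h]; exact φ.exists_congr_left.trans (by simp)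
      have h2 : (∃! j, a.2 j = ⟨1⟩) ↔ ∃! j, b.2 j = ⟨1⟩ := by
        simp only [h]; exact φ.existsUnique_congr (by simp)
      simp only [h1, h2])

theorem mem_unitSum_of {I : Type w} [Countable I] (n : I → ULift.{u} (Fin 2))
    (a : ULift.{u} (Fin 2)) : a ∈ unitSum (Family.of n) ↔
      (a = ⟨0⟩ ∧ ¬ ∃ j, n j = ⟨1⟩) ∨ (a = ⟨1⟩ ∧ ∃! j, n j = ⟨1⟩) := by
  classical
  set e := Equiv.ofInjective _ (exists_injective_nat I).choose_spec
  have h1 : (∃ j, n (e.symm j) = ⟨1⟩) ↔ ∃ j, n j = ⟨1⟩ :=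
    e.symm.exists_congr_left.trans (by simp)
  have h2 : (∃! j, n (e.symm j) = ⟨1⟩) ↔ ∃! j, n j = ⟨1⟩ :=
    e.symm.existsUnique_congr (by simp)
  change a ∈ (if ¬ ∃ j, n (e.symm j) = ⟨1⟩ then Part.some ⟨0⟩
    else if ∃! j, n (e.symm j) = ⟨1⟩ then Part.some ⟨1⟩ else Part.none) ↔ _
  simp only [h1, h2]
  have h3 : (∃! j, n j = ⟨1⟩) → ∃ j, n j = ⟨1⟩ := fun h => h.exists
  split_ifs with h h' <;> simp only [Part.mem_some_iff, Part.notMem_none] <;> tauto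

theorem unitSum_sigma {J : Type v} [Countable J] {K : J → Type w} [∀ j, Countable (K j)]
    (x : ∀ j, K j → ULift.{u} (Fin 2)) (s : J → ULift.{u} (Fin 2))
    (h : ∀ j, s j ∈ unitSum (Family.of (x j))) (a : ULift.{u} (Fin 2)) :
    a ∈ unitSum (Family.of (fun q : Σ j, K j => x q.1 q.2)) ↔ a ∈ unitSum (Family.of s) := by
  simp only [mem_unitSum_of] at h ⊢
  have h01 : (⟨0⟩ : ULift.{u} (Fin 2)) ≠ ⟨1⟩ := by simp
  have hs : ∀ j, s j = ⟨1⟩ ↔ ∃ k, x j k = ⟨1⟩ := by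
    intro j
    rcases h j with ⟨h0, h1⟩ | ⟨h0, h1⟩
    · rw [h0]; exact ⟨fun e => (h01 e).elim, fun e => (h1 e).elim⟩
    · exact ⟨fun _ => h1.exists, fun _ => h0⟩
  have hu : ∀ j k k', x j k = ⟨1⟩ → x j k' = ⟨1⟩ → k = k' := by
    intro j k k' hk hk'
    rcases h j with ⟨_, h1⟩ | ⟨_, h1⟩
    · exact (h1 ⟨k, hk⟩).elim
    · exact h1.unique hk hk'
  have e1 : (∃ q : Σ j, K j, x q.1 q.2 = ⟨1⟩) ↔ ∃ j, s j = ⟨1⟩ := by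
    simp only [hs, Sigma.exists]
  have e2 : (∃! q : Σ j, K j, x q.1 q.2 = ⟨1⟩) ↔ ∃! j, s j = ⟨1⟩ := by
    constructor
    · rintro ⟨⟨j, k⟩, hq, hq'⟩
      refine ⟨j, (hs j).2 ⟨k, hq⟩, fun j' hj' => ?_⟩
      obtain ⟨k', hk'⟩ := (hs j').1 hj'
      exact congrArg Sigma.fst (hq' ⟨j', k'⟩ hk')
    · rintro ⟨j, hj, hj'⟩
      obtain ⟨k, hk⟩ := (hs j).1 hj
      refine ⟨⟨j, k⟩, hk, ?_⟩
      rintro ⟨j', k'⟩ hk'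
      obtain rfl := hj' j' ((hs j').2 ⟨k', hk'⟩)
      exact congrArg _ (hu _ _ _ hk' hk)
  rw [e1, e2]

/-- The weak `Σ`-monoid `I = ({0, 1}, Σ)`. -/
noncomputable def unit : WeakSigmaMonoid.{u} where
  carrier := ULift.{u} (Fin 2)
  sum := unitSum
  sum_single x := by
    rw [Family.single, mem_unitSum_of]
    obtain ⟨x⟩ := x
    fin_cases x
    · left; simp
    · right; simp
  neutral := by
    refine ⟨⟨0⟩, by rw [Family.empty, mem_unitSum_of]; simp, ?_⟩
    intro J _ x hx
    obtain ⟨a, ha⟩ := Part.dom_iff_mem.1 hx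
    refine Part.dom_iff_mem.2 ⟨a, ?_⟩
    rw [mem_unitSum_of] at ha ⊢
    rcases ha with ⟨h0, h1⟩ | ⟨h0, j, hj, hj'⟩
    · exact Or.inl ⟨h0, fun ⟨i, hi⟩ => h1 ⟨i, hi⟩⟩
    · exact Or.inr ⟨h0, ⟨j, by rw [hj]; simp⟩, hj, fun i hi => Subtype.ext (hj' i hi)⟩
  bracketing x s h a := (unitSum_sigma x s h a).1
  flattening x s h a := (unitSum_sigma x s h a).2

end Unit

end WeakSigmaMonoid

/-! ### The four categories of `Σ`-monoids and their embeddings -/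

/-- The four flavours of `Σ`-monoids. -/
inductive SigmaKind
  | weak
  | strong
  | finTotal
  | group

/-- The class of weak `Σ`-monoids of the given flavour. -/
def SigmaKind.prop : SigmaKind → ObjectProperty WeakSigmaMonoid.{u}
  | .weak => fun _ => True
  | .strong => fun X => X.IsStrong
  | .finTotal => fun X => X.IsFinitelyTotal
  | .group => fun X => X.IsSigmaGroup

/-- The full subcategory of weak `Σ`-monoids of the given flavour. -/
abbrev SCat (c : SigmaKind) := (SigmaKind.prop.{u} c).FullSubcategory

namespace SCat

variable {c d : SigmaKind}

/-- The underlying set of an object. -/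
abbrev El (X : SCat.{u} c) : Type u := X.obj.carrier

/-- The underlying function of a morphism. -/
abbrev fn {X Y : SCat.{u} c} (f : X ⟶ Y) : El X → El Y := f.hom.toFun

/-- The embedding functor between two of the categories, when every `Σ`-monoid of the first kind is
one of the second kind. -/
abbrev emb (h : SigmaKind.prop.{u} c ≤ SigmaKind.prop.{u} d) : SCat.{u} c ⥤ SCat.{u} d :=
  ObjectProperty.ιOfLE h

theorem le_weak (c : SigmaKind) : SigmaKind.prop.{u} c ≤ SigmaKind.prop.{u} .weak :=
  fun _ _ => trivial

theorem group_le_finTotal : SigmaKind.prop.{u} .group ≤ SigmaKind.prop.{u} .finTotal :=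
  fun _ h => h.1

/-- The underlying function `X → F X` of the unit of an adjunction between a reflector `F` and an
embedding. -/
abbrev unitFn {h : SigmaKind.prop.{u} c ≤ SigmaKind.prop.{u} d} {F : SCat.{u} d ⥤ SCat.{u} c}
    (adj : F ⊣ emb h) (X : SCat.{u} d) : El X → El (F.obj X) :=
  fn (adj.unit.app X)

/-- The embedding into the category of weak `Σ`-monoids. -/
abbrev toWeak (c : SigmaKind) : SCat.{u} c ⥤ SCat.{u} .weak := emb (le_weak c)

/-- The object `I = {0, 1}` of the category of weak `Σ`-monoids. -/
noncomputable def unit : SCat.{u} .weak := ⟨WeakSigmaMonoid.unit, trivial⟩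

/-- `f : X × Y → Z` is `Σ`-bilinear. -/
def IsBilinear (X Y Z : SCat.{u} c) (f : El X → El Y → El Z) : Prop :=
  (∀ x, WeakSigmaMonoid.IsHom Y.obj Z.obj (fun y => f x y)) ∧
    ∀ y, WeakSigmaMonoid.IsHom X.obj Z.obj (fun x => f x y)

/-- `(p, T)` is the tensor product of `X` and `Y` in the category `SCat c`, that is, the universal
`Σ`-bilinear function out of `X × Y`. -/
structure IsTensorProduct (X Y T : SCat.{u} c) (p : El X → El Y → El T) : Prop where
  bilinear : IsBilinear X Y T p
  existsUnique : ∀ (Z : SCat.{u} c) (f : El X → El Y → El Z), IsBilinear X Y Z f →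
    ∃! g : T ⟶ Z, ∀ x y, fn g (p x y) = f x y

/-- The symmetric monoidal structure on `SCat c` is the one given by the tensor product: every
`X ⊗ Y` is the tensor product of `X` and `Y` with universal `Σ`-bilinear function `p X Y`, and the
functor `⊗`, the associator, the unitors and the braiding are the liftings of those of the cartesian
product of sets, `e` being the element `1` of the monoidal unit. -/
structure IsTensorMonoidal [MonoidalCategory (SCat.{u} c)] [SymmetricCategory (SCat.{u} c)]
    (p : ∀ X Y : SCat.{u} c, El X → El Y → El (X ⊗ Y)) (e : El (𝟙_ (SCat.{u} c))) : Prop where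
  isTensorProduct : ∀ X Y, IsTensorProduct X Y (X ⊗ Y) (p X Y)
  tensorHom : ∀ {X Y Z W : SCat.{u} c} (f : X ⟶ Z) (g : Y ⟶ W) (x : El X) (y : El Y),
    fn (f ⊗ₘ g) (p X Y x y) = p Z W (fn f x) (fn g y)
  associator : ∀ (X Y Z : SCat.{u} c) (x : El X) (y : El Y) (z : El Z),
    fn (α_ X Y Z).hom (p (X ⊗ Y) Z (p X Y x y) z) = p X (Y ⊗ Z) x (p Y Z y z)
  leftUnitor : ∀ (X : SCat.{u} c) (x : El X), fn (λ_ X).hom (p _ X e x) = x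
  rightUnitor : ∀ (X : SCat.{u} c) (x : El X), fn (ρ_ X).hom (p X _ x e) = x
  braiding : ∀ (X Y : SCat.{u} c) (x : El X) (y : El Y),
    fn (β_ X Y).hom (p X Y x y) = p Y X y x

end SCat

/-! Each of the four categories admits presentations by generators and relations, and is closed
under pointwise internal homs; the theorem follows formally from these two facts.

Presentations: consider formal terms built from generators by countable sums and inverses. Keep
those that have a value in every object of `SCat c` interpreting the relations, and identify two
when their values always agree. Interpretations form a large collection, but they are only
quantified over in propositions, so the quotient of terms stays in the universe of the generators. A
family sums to `a` when it does so in every interpretation (`initial`). Whatever sum or inverse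
exists in every interpretation is named by a term, so the result lies in `SCat c`
(`presentedObj_prop`). Evaluation gives lifts (`exists_presented_lift`) and induction on terms gives
uniqueness (`presented_hom_ext`). The tensor product (generators `X × Y`, bilinearity relations),
the unit (one generator, no relations) and the reflections (generators the elements, relations the
sums that hold) are all such objects.

Internal homs: `internalHom X Y` has the flavour of `Y` for every weak `X` (`internalHom_prop`).
Hence multilinear functions extend one variable at a time, which yields the associator, closedness,
and, since the source may lie in a larger category than the target, the isomorphisms `F X ⊗ F Y ≅ F
(X ⊗ Y)` (`exists_reflect_tensor_lift`). All coherence laws are then compared on pure tensors of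
generators. -/

/-- The partial element singled out by a predicate. -/
noncomputable def partOf {α : Type u} (R : α → Prop) : Part α := ⟨∃ a, R a, fun h => h.choose⟩

theorem mem_partOf {α : Type u} {R : α → Prop} (hR : ∀ a b, R a → R b → a = b) (a : α) :
    a ∈ partOf R ↔ R a := by
  constructor
  · rintro ⟨h, rfl⟩
    exact h.choose_spec
  · intro h
    exact ⟨⟨a, h⟩, hR _ _ (Exists.choose_spec (⟨a, h⟩ : ∃ a, R a)) h⟩

theorem Family.map_empty {X : Type u} {Y : Type v} (f : X → Y) :
    Family.map f Family.empty = Family.empty :=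
  (map_of f _).trans (congrArg of (funext fun i => i.elim))

theorem Family.map_pair {X : Type u} {Y : Type v} (f : X → Y) (x y : X) :
    Family.map f (Family.pair x y) = Family.pair (f x) (f y) :=
  (map_of f _).trans (congrArg of (funext fun b => by cases b <;> rfl))

namespace WeakSigmaMonoid

variable {X Y Z : WeakSigmaMonoid.{u}}

/-! ### Elementary properties of sums -/

theorem mem_sum_reindex {ι κ : Type} [Countable ι] [Countable κ] (e : ι ≃ κ) {x : ι → X.carrier}
    {y : κ → X.carrier} (h : ∀ i, x i = y (e i)) {a : X.carrier} (ha : a ∈ X.sum (Family.of x)) :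
    a ∈ X.sum (Family.of y) := by
  rwa [← Family.of_eq_of_iff.2 ⟨e, h⟩]

theorem mem_sum_of_unique {ι : Type} [Unique ι] (x : ι → X.carrier) :
    x default ∈ X.sum (Family.of x) :=
  mem_sum_reindex (Equiv.ofUnique Unit ι) (fun _ => congrArg x (Subsingleton.elim _ _))
    (X.sum_single (x default))

theorem zero_mem_sum_of_isEmpty {ι : Type} [IsEmpty ι] (x : ι → X.carrier) :
    X.zero ∈ X.sum (Family.of x) :=
  mem_sum_reindex (Equiv.equivOfIsEmpty Empty ι) (fun i => i.elim) X.zero_mem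

/-- Inserting zeros is an instance of bracketing: each index carries a piece with one element or
none, and the empty pieces contribute `0`. -/
theorem mem_sum_of_subtype {ι : Type} [Countable ι] {P : ι → Prop} {x : ι → X.carrier}
    (h0 : ∀ i, ¬ P i → x i = X.zero) {a : X.carrier}
    (ha : a ∈ X.sum (Family.of fun i : {i // P i} => x i)) : a ∈ X.sum (Family.of x) := by
  refine X.bracketing (K := fun i => PLift (P i)) (fun i _ => x i) x (fun i => ?_) a ?_
  · by_cases hi : P i
    · have : Unique (PLift (P i)) := ⟨⟨⟨hi⟩⟩, fun _ => rfl⟩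
      exact mem_sum_of_unique (fun _ : PLift (P i) => x i)
    · have : IsEmpty (PLift (P i)) := ⟨fun h => hi h.down⟩
      rw [h0 i hi]
      exact zero_mem_sum_of_isEmpty _
  · exact mem_sum_reindex (X := X)
      (⟨fun i => ⟨i.1, ⟨i.2⟩⟩, fun q => ⟨q.1, q.2.down⟩, fun _ => rfl, fun _ => rfl⟩ :
        {i // P i} ≃ Σ i, PLift (P i)) (fun _ => rfl) ha

/-- The neutral element axiom only drops all zeros at once and does not give the value of the new
sum. Reinserting every zero identifies that value; reinserting only the zeros inside `P` gives the
claim. -/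
theorem mem_sum_subtype {ι : Type} [Countable ι] {P : ι → Prop} {x : ι → X.carrier}
    (h0 : ∀ i, ¬ P i → x i = X.zero) {a : X.carrier} (ha : a ∈ X.sum (Family.of x)) :
    a ∈ X.sum (Family.of fun i : {i // P i} => x i) := by
  obtain ⟨b, hb⟩ := Part.dom_iff_mem.1 (X.neutral.choose_spec.2 x (Part.dom_iff_mem.2 ⟨a, ha⟩))
  change b ∈ X.sum (Family.of fun i : {i // x i ≠ X.zero} => x i) at hb
  obtain rfl : b = a :=
    Part.mem_unique (mem_sum_of_subtype (fun i hi => not_not.1 hi) hb) ha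
  refine mem_sum_of_subtype (P := fun i : {i // P i} => x i ≠ X.zero) (fun i hi => not_not.1 hi) ?_
  refine mem_sum_reindex (X := X)
    (⟨fun i => ⟨⟨i.1, ?_⟩, i.2⟩, fun i => ⟨i.1.1, i.2⟩, fun _ => rfl, fun _ => rfl⟩ :
      {i // x i ≠ X.zero} ≃ {i : {i // P i} // x i ≠ X.zero}) (fun _ => rfl) hb
  by_contra h
  exact i.2 (h0 _ h)

theorem zero_mem_sum_zero (X : WeakSigmaMonoid.{u}) (ι : Type) [Countable ι] :
    X.zero ∈ X.sum (Family.of fun _ : ι => X.zero) :=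
  mem_sum_of_subtype (P := fun _ => False) (fun _ _ => rfl)
    (have : IsEmpty {_i : ι // False} := ⟨fun i => i.2⟩
     zero_mem_sum_of_isEmpty _)

theorem mem_sum_of_eq_zero {ι : Type} [Countable ι] {x : ι → X.carrier} (i : ι)
    (h : ∀ j, j ≠ i → x j = X.zero) : x i ∈ X.sum (Family.of x) :=
  mem_sum_of_subtype (P := fun j => j = i) h
    (mem_sum_of_unique (fun j : {j // j = i} => x j))

/-- Flattening for two summands. -/
theorem mem_sum_sumElim {ι κ : Type} [Countable ι] [Countable κ] {x : ι → X.carrier}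
    {y : κ → X.carrier} {a b c : X.carrier} (ha : a ∈ X.sum (Family.of x))
    (hb : b ∈ X.sum (Family.of y)) (hc : c ∈ X.sum (Family.pair a b)) :
    c ∈ X.sum (Family.of (Sum.elim x y)) := by
  have : ∀ i : Bool, Countable (cond i ι κ) := fun i => by cases i <;> assumption
  have h := X.flattening (J := Bool) (K := fun i => cond i ι κ)
    (fun i => match i with
      | true => x
      | false => y) (fun i => cond i a b) (by rintro (_ | _) <;> assumption) c hc
  -- `Equiv.sumEquivSigmaBool` puts the index `false` on the left, whereas `x` sits at `true`;
  -- `Equiv.sumComm` corrects this.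
  refine mem_sum_reindex (X := X)
    ((Equiv.sumEquivSigmaBool κ ι).symm.trans (Equiv.sumComm κ ι)) ?_ h
  rintro ⟨_ | _, k⟩ <;> rfl

/-- Uniqueness of inverses, without finite totality: the family `{z, y, z'}` sums to `z` as `z + (y
+ z')` and to `z'` as `z' + (y + z)`. Both are flattenings of families `{z, 0}` and `{z', 0}`, which
are always summable. -/
theorem eq_of_zero_mem_sum_pair {y z z' : X.carrier} (h : X.zero ∈ X.sum (Family.pair y z))
    (h' : X.zero ∈ X.sum (Family.pair y z')) : z = z' := by
  have key : ∀ z z' : X.carrier, X.zero ∈ X.sum (Family.pair y z') →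
      z ∈ X.sum (Family.of (Sum.elim (fun _ : Unit => z) (fun b : Bool => cond b y z'))) := by
    intro z z' h'
    refine mem_sum_sumElim (X.sum_single z) h' ?_
    exact mem_sum_of_eq_zero (x := fun b : Bool => cond b z X.zero) true
      (by rintro (_ | _) h <;> simp_all)
  refine Part.mem_unique (key z z' h') (mem_sum_reindex (Equiv.swap (Sum.inl ()) (Sum.inr false)) ?_
    (key z' z h))
  rintro (_ | _ | _)
  · simp
  · simp
  · rw [Equiv.swap_apply_of_ne_of_ne (by simp) (by simp)]; rfl

/-! ### Homomorphisms -/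

theorem isHom_iff {f : X.carrier → Y.carrier} :
    IsHom X Y f ↔ ∀ {ι : Type} [Countable ι] (x : ι → X.carrier) (a : X.carrier),
      a ∈ X.sum (Family.of x) → f a ∈ Y.sum (Family.of fun i => f (x i)) := by
  constructor
  · intro h ι _ x a ha
    exact h _ _ ha
  · intro h s a ha
    obtain ⟨I, x, rfl⟩ := Family.exists_of s
    exact h x a ha

theorem IsHom.comp {g : Y.carrier → Z.carrier} {f : X.carrier → Y.carrier} (hg : IsHom Y Z g)
    (hf : IsHom X Y f) : IsHom X Z fun x => g (f x) := by
  intro s a ha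
  rw [← Family.map_map]
  exact hg _ _ (hf _ _ ha)

theorem isHom_id : IsHom X X fun x => x := fun s x h => by rwa [Family.map_id']

theorem IsHom.map_zero {f : X.carrier → Y.carrier} (hf : IsHom X Y f) : f X.zero = Y.zero :=
  Part.mem_unique (hf _ _ X.zero_mem) (by rw [Family.map_empty]; exact Y.zero_mem)

theorem IsHom.map_pair {f : X.carrier → Y.carrier} (hf : IsHom X Y f) {x y a : X.carrier}
    (h : a ∈ X.sum (Family.pair x y)) : f a ∈ Y.sum (Family.pair (f x) (f y)) :=
  Family.map_pair f x y ▸ hf _ _ h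

theorem isHom_zero (X Y : WeakSigmaMonoid.{u}) : IsHom X Y fun _ => Y.zero :=
  isHom_iff.2 fun {ι} _ _ _ _ => zero_mem_sum_zero Y ι

/-! ### Initial structures -/

section Initial

variable {ι : Type w} {C : Type u} (Z : ι → WeakSigmaMonoid.{u}) (f : ∀ i, C → (Z i).carrier)
  (hf : ∀ a b, (∀ i, f i a = f i b) → a = b)

/-- The weak `Σ`-monoid structure on a set `C` for which a family sums to `a` exactly if this is so
after applying each one of a jointly injective collection of functions to weak `Σ`-monoids. -/
noncomputable def initial (z : C) (hz : ∀ i, f i z = (Z i).zero) : WeakSigmaMonoid.{u} where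
  carrier := C
  sum s := partOf fun a => ∀ i, f i a ∈ (Z i).sum (s.map (f i))
  sum_single x := (mem_partOf (fun a b ha hb => hf a b fun i => Part.mem_unique (ha i) (hb i)) _).2
    fun i => (Z i).sum_single (f i x)
  neutral := by
    have mem := fun s : Family C => mem_partOf (R := fun a => ∀ i, f i a ∈ (Z i).sum (s.map (f i)))
      (fun a b ha hb => hf a b fun i => Part.mem_unique (ha i) (hb i))
    refine ⟨z, (mem _ _).2 fun i => ?_, fun x hx => ?_⟩
    · rw [hz, Family.map_empty]
      exact (Z i).zero_mem
    · obtain ⟨a, ha⟩ := Part.dom_iff_mem.1 hx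
      refine Part.dom_iff_mem.2 ⟨a, (mem _ _).2 fun i => ?_⟩
      refine mem_sum_subtype (x := fun j => f i (x j)) (fun j hj => ?_) ((mem _ _).1 ha i)
      rw [not_not.1 hj, hz]
  bracketing x s h a ha := by
    have mem := fun s : Family C => mem_partOf (R := fun a => ∀ i, f i a ∈ (Z i).sum (s.map (f i)))
      (fun a b ha hb => hf a b fun i => Part.mem_unique (ha i) (hb i))
    exact (mem _ _).2 fun i => (Z i).bracketing (fun j k => f i (x j k)) (fun j => f i (s j))
      (fun j => (mem _ _).1 (h j) i) _ ((mem _ _).1 ha i)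
  flattening x s h a ha := by
    have mem := fun s : Family C => mem_partOf (R := fun a => ∀ i, f i a ∈ (Z i).sum (s.map (f i)))
      (fun a b ha hb => hf a b fun i => Part.mem_unique (ha i) (hb i))
    exact (mem _ _).2 fun i => (Z i).flattening (fun j k => f i (x j k)) (fun j => f i (s j))
      (fun j => (mem _ _).1 (h j) i) _ ((mem _ _).1 ha i)

variable {Z f hf} {z : C} {hz : ∀ i, f i z = (Z i).zero}

theorem mem_initial_sum {s : Family C} {a : C} :
    a ∈ (initial Z f hf z hz).sum s ↔ ∀ i, f i a ∈ (Z i).sum (s.map (f i)) :=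
  mem_partOf (fun a b ha hb => hf a b fun i => Part.mem_unique (ha i) (hb i)) _

theorem initial_zero : (initial Z f hf z hz).zero = z := by
  refine Part.mem_unique (initial Z f hf z hz).zero_mem (mem_initial_sum.2 fun i => ?_)
  exact hz i ▸ (Family.map_empty (f i)).symm ▸ (Z i).zero_mem

theorem isHom_initial_iff {f' : Y.carrier → C} :
    IsHom Y (initial Z f hf z hz) f' ↔ ∀ i, IsHom Y (Z i) fun y => f i (f' y) := by
  constructor
  · intro h i s a ha
    rw [← Family.map_map]
    exact mem_initial_sum.1 (h s a ha) i
  · intro h s a ha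
    exact mem_initial_sum.2 fun i => (Family.map_map (f i) f' s).symm ▸ h i s a ha

/-- Bracketing and flattening compare given sums and so are inherited from the targets; only
subsummability asks for a new element of `C`, hence the hypothesis `hsub`. -/
theorem initial_isStrong (hZ : ∀ i, (Z i).IsStrong)
    (hsub : ∀ {I : Type} [Countable I] (x : I → C) (a : C),
      (∀ i, f i a ∈ (Z i).sum (Family.of fun k => f i (x k))) → ∀ S : Set I,
        ∃ b, ∀ i, f i b ∈ (Z i).sum (Family.of fun k : S => f i (x k))) :
    (initial Z f hf z hz).IsStrong where
  subsummability x hx S := by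
    obtain ⟨a, ha⟩ := Part.dom_iff_mem.1 hx
    obtain ⟨b, hb⟩ := hsub x a (mem_initial_sum.1 ha) S
    exact Part.dom_iff_mem.2 ⟨b, mem_initial_sum.2 hb⟩
  strong_bracketing x s h a ha := mem_initial_sum.2 fun i =>
    (hZ i).strong_bracketing (fun j k => f i (x j k)) (fun j => f i (s j))
      (fun j => mem_initial_sum.1 (h j) i) _ (mem_initial_sum.1 ha i)
  strong_flattening x s h a ha := mem_initial_sum.2 fun i =>
    (hZ i).strong_flattening (fun j k => f i (x j k)) (fun j => f i (s j))
      (fun j => mem_initial_sum.1 (h j) i) _ (mem_initial_sum.1 ha i)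

theorem initial_isFinitelyTotal
    (h : ∀ {I : Type} [Finite I] (x : I → C),
      ∃ b, ∀ i, f i b ∈ (Z i).sum (Family.of fun k => f i (x k))) :
    (initial Z f hf z hz).IsFinitelyTotal := fun x => by
  obtain ⟨b, hb⟩ := h x
  exact Part.dom_iff_mem.2 ⟨b, mem_initial_sum.2 hb⟩

theorem initial_isSigmaGroup
    (hfin : (initial Z f hf z hz).IsFinitelyTotal) (neg : C → C)
    (negZ : ∀ i, (Z i).carrier → (Z i).carrier)
    (h0 : ∀ i x, (Z i).zero ∈ (Z i).sum (Family.pair x (negZ i x)))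
    (hneg : ∀ i, IsHom (Z i) (Z i) (negZ i)) (h : ∀ i a, f i (neg a) = negZ i (f i a)) :
    (initial Z f hf z hz).IsSigmaGroup := by
  refine ⟨hfin, neg, fun x => mem_initial_sum.2 fun i => ?_, isHom_initial_iff.2 fun i => ?_⟩
  · rw [initial_zero, hz]
    exact (Family.map_pair (f i) x (neg x)).symm ▸ (h i x).symm ▸ h0 i (f i x)
  · have := (hneg i).comp (isHom_initial_iff.1 (isHom_id (X := initial Z f hf z hz)) i)
    exact (funext (h i)).symm ▸ this

end Initial

/-! ### Internal homs -/

/-- The weak `Σ`-monoid of homomorphisms `X → Y` with the pointwise sum. -/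
noncomputable def internalHom (X Y : WeakSigmaMonoid.{u}) : WeakSigmaMonoid.{u} :=
  initial (C := Hom X Y) (fun _ : X.carrier => Y) (fun x f => f.toFun x)
    (fun _ _ h => Hom.ext (funext h)) ⟨_, isHom_zero X Y⟩ (fun _ => rfl)

theorem mem_sum_prod_of_comm {ι κ : Type} [Countable ι] [Countable κ] {x : ι → κ → X.carrier}
    {a : X.carrier} (h : a ∈ X.sum (Family.of fun q : Σ _ : ι, κ => x q.1 q.2)) :
    a ∈ X.sum (Family.of fun q : Σ _ : κ, ι => x q.2 q.1) :=
  mem_sum_reindex (⟨fun q => ⟨q.2, q.1⟩, fun q => ⟨q.2, q.1⟩, fun _ => rfl, fun _ => rfl⟩ :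
    (Σ _ : ι, κ) ≃ Σ _ : κ, ι) (fun _ => rfl) h

/-- A finite pointwise sum of homomorphisms is a homomorphism. -/
theorem isHom_of_finite_sum {I : Type} [Finite I] (f : I → Hom X Y)
    (g : X.carrier → Y.carrier) (hg : ∀ x, g x ∈ Y.sum (Family.of fun i => (f i).toFun x)) :
    IsHom X Y g := isHom_iff.2 fun x a ha =>
  -- The double family is flattened along the finite index `I` and then bracketed into the pieces
  -- with fixed `k`, which are finite. The weak axioms permit exactly this exchange of sums.
  Y.bracketing (fun k i => (f i).toFun (x k)) _ (fun k => hg (x k)) _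
    (mem_sum_prod_of_comm (x := fun i k => (f i).toFun (x k))
      (Y.flattening (fun i k => (f i).toFun (x k)) _ (fun i => (f i).isHom _ _ ha) _ (hg a)))

theorem internalHom_isFinitelyTotal (hY : Y.IsFinitelyTotal) :
    (internalHom X Y).IsFinitelyTotal :=
  initial_isFinitelyTotal fun f => by
    choose g hg using fun x => Part.dom_iff_mem.1 (hY fun i => (f i).toFun x)
    exact ⟨⟨g, isHom_of_finite_sum f g hg⟩, hg⟩

theorem internalHom_isSigmaGroup (hY : Y.IsSigmaGroup) : (internalHom X Y).IsSigmaGroup := by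
  obtain ⟨hY, neg, h0, hneg⟩ := hY
  exact initial_isSigmaGroup (internalHom_isFinitelyTotal hY)
    (fun f => ⟨_, hneg.comp f.isHom⟩) (fun _ => neg) (fun _ => h0) (fun _ => hneg) fun _ _ => rfl

theorem internalHom_isStrong (hY : Y.IsStrong) : (internalHom X Y).IsStrong :=
  initial_isStrong (fun _ => hY) fun {I} _ f a ha S => by
    choose g hg using fun x =>
      Part.dom_iff_mem.1 (hY.subsummability _ (Part.dom_iff_mem.2 ⟨_, ha x⟩) S)
    refine ⟨⟨g, isHom_iff.2 fun {κ} _ x b hb => ?_⟩, hg⟩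
    -- The pointwise subsum `g` is a homomorphism: the double family over `I × κ` is summable, hence
    -- so is its part over `S × κ`. Bracketing that part by rows shows that its sum is `g b`;
    -- bracketing by columns shows that it is the sum of the `g (x k)`.
    have h1 := hY.strong_flattening (fun i k => (f i).toFun (x k)) _
      (fun i => (f i).isHom _ _ hb) _ (ha b)
    obtain ⟨c, hc⟩ := Part.dom_iff_mem.1
      (hY.subsummability _ (Part.dom_iff_mem.2 ⟨_, h1⟩) {q | q.1 ∈ S})
    have h2 : c ∈ Y.sum (Family.of fun q : Σ _ : S, κ => (f q.1).toFun (x q.2)) :=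
      mem_sum_reindex (X := Y) (⟨fun q => ⟨⟨q.1.1, q.2⟩, q.1.2⟩, fun q => ⟨⟨q.1, q.2⟩, q.1.2⟩,
        fun _ => rfl, fun _ => rfl⟩ : {q : Σ _ : I, κ | q.1 ∈ S} ≃ Σ _ : S, κ) (fun _ => rfl) hc
    obtain rfl : c = g b := Part.mem_unique
      (hY.strong_bracketing (fun (i : S) k => (f i).toFun (x k)) _
        (fun i => (f i).isHom _ _ hb) _ h2) (hg b)
    exact hY.strong_bracketing (fun k (i : S) => (f i).toFun (x k)) _ (fun k => hg (x k)) _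
      (mem_sum_prod_of_comm (x := fun (i : S) k => (f i).toFun (x k)) h2)

end WeakSigmaMonoid

/-! ### Presentations of `Σ`-monoids by generators and relations -/

/-- Formal expressions in generators from `A`. -/
inductive SigmaTerm (A : Type u) : Type u
  | gen (a : A)
  | sum (I : Set ℕ) (t : I → SigmaTerm A)
  | neg (t : SigmaTerm A)

namespace SigmaTerm

variable {A : Type u}

/-- The expression `t` is defined in `Z`, with value `z`, when the generators are interpreted
by `f`. -/
def Evals (Z : WeakSigmaMonoid.{u}) (f : A → Z.carrier) : SigmaTerm A → Z.carrier → Prop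
  | gen a, z => z = f a
  | sum I t, z => ∃ v : I → Z.carrier, (∀ i, Evals Z f (t i) (v i)) ∧ z ∈ Z.sum (Family.of v)
  -- Inverses are described by a relation, so that the clause makes sense, as a partial operation,
  -- in any weak `Σ`-monoid.
  | neg t, z => ∃ y, Evals Z f t y ∧ Z.zero ∈ Z.sum (Family.pair y z)

theorem Evals.unique {Z : WeakSigmaMonoid.{u}} {f : A → Z.carrier} {t : SigmaTerm A} :
    ∀ {z z' : Z.carrier}, Evals Z f t z → Evals Z f t z' → z = z' := by
  induction t with
  | gen a => intro z z' h h'; exact h.trans h'.symm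
  | sum I t ih =>
    rintro z z' ⟨v, hv, h⟩ ⟨v', hv', h'⟩
    obtain rfl : v = v' := funext fun i => ih i (hv i) (hv' i)
    exact Part.mem_unique h h'
  | neg t ih =>
    rintro z z' ⟨v, hv, h⟩ ⟨v', hv', h'⟩
    obtain rfl := ih hv hv'
    exact WeakSigmaMonoid.eq_of_zero_mem_sum_pair h h'

end SigmaTerm

namespace SCat

section Presentation

/-- `f` respects the relations `∑ s = a` for all `s` and `a` with `R s a`. -/
def Respects {A : Type u} (R : Family A → A → Prop) (Z : WeakSigmaMonoid.{u})
    (f : A → Z.carrier) : Prop :=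
  ∀ s a, R s a → f a ∈ Z.sum (s.map f)

variable (c : SigmaKind) {A : Type u} (R : Family A → A → Prop)

/-- An interpretation of generators and relations in an object of `SCat c`. -/
structure Interpretation where
  obj : SCat.{u} c
  fn : A → El obj
  respects : Respects R obj.obj fn

/-- The expressions that are defined in all interpretations. -/
def DefinedTerm : Type u :=
  {t : SigmaTerm A // ∀ i : Interpretation c R, ∃ z, t.Evals i.obj.obj i.fn z}

variable {c R} in
/-- The value of an expression in an interpretation. -/
noncomputable def DefinedTerm.val (i : Interpretation c R) (t : DefinedTerm c R) : El i.obj :=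
  (t.2 i).choose

variable {c R} in
theorem DefinedTerm.evals_val (i : Interpretation c R) (t : DefinedTerm c R) :
    t.1.Evals i.obj.obj i.fn (t.val i) :=
  (t.2 i).choose_spec

/-- Expressions are equivalent if they have equal values in all interpretations. -/
def definedTermSetoid : Setoid (DefinedTerm c R) where
  r t t' := ∀ i, t.val i = t'.val i
  iseqv := ⟨fun _ _ => rfl, fun h i => (h i).symm, fun h h' i => (h i).trans (h' i)⟩

/-- The set of expressions modulo equivalence. -/
def PresentedEl : Type u := Quotient (definedTermSetoid c R)

namespace PresentedEl

variable {c R}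

/-- The class of an expression. -/
def mk (t : SigmaTerm A) (ht : ∀ i : Interpretation c R, ∃ z, t.Evals i.obj.obj i.fn z) :
    PresentedEl c R :=
  Quotient.mk _ ⟨t, ht⟩

/-- The value of an element in an interpretation. -/
noncomputable def ev (i : Interpretation c R) : PresentedEl c R → El i.obj :=
  Quotient.lift (DefinedTerm.val i) fun _ _ h => h i

theorem ev_mk {i : Interpretation c R} {t : SigmaTerm A} {ht} {z : El i.obj}
    (h : t.Evals i.obj.obj i.fn z) : ev i (mk t ht) = z :=
  (DefinedTerm.evals_val i ⟨t, ht⟩).unique h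

theorem ext (a b : PresentedEl c R) (h : ∀ i, ev i a = ev i b) : a = b := by
  induction a using Quotient.inductionOn
  induction b using Quotient.inductionOn
  exact Quotient.sound h

theorem exists_rep (a : PresentedEl c R) :
    ∃ t : SigmaTerm A, ∀ i, t.Evals i.obj.obj i.fn (ev i a) := by
  induction a using Quotient.inductionOn with
  | h t => exact ⟨t.1, fun i => t.evals_val i⟩

/-- A family which is summable in every interpretation has a sum. -/
theorem exists_sum (s : Family (PresentedEl c R))
    (hs : ∀ i : Interpretation c R, (i.obj.obj.sum (s.map (ev i))).Dom) :
    ∃ a, ∀ i : Interpretation c R, ev i a ∈ i.obj.obj.sum (s.map (ev i)) := by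
  obtain ⟨I, x, rfl⟩ := Family.exists_of s
  choose t ht using fun k => exists_rep (x k)
  choose z hz using fun i => Part.dom_iff_mem.1 (hs i)
  have h : ∀ i : Interpretation c R, (SigmaTerm.sum I t).Evals i.obj.obj i.fn (z i) :=
    fun i => ⟨_, fun k => ht k i, hz i⟩
  refine ⟨mk (.sum I t) fun i => ⟨z i, h i⟩, fun i => ?_⟩
  rw [ev_mk (h i)]
  exact hz i

/-- An element which has an inverse in every interpretation has an inverse. -/
theorem exists_neg (a : PresentedEl c R) (n : ∀ i : Interpretation c R, El i.obj)
    (hn : ∀ i : Interpretation c R, i.obj.obj.zero ∈ i.obj.obj.sum (Family.pair (ev i a) (n i))) :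
    ∃ b, ∀ i : Interpretation c R, ev i b = n i := by
  obtain ⟨t, ht⟩ := exists_rep a
  have h : ∀ i : Interpretation c R, (SigmaTerm.neg t).Evals i.obj.obj i.fn (n i) :=
    fun i => ⟨_, ht i, hn i⟩
  exact ⟨mk (.neg t) fun i => ⟨n i, h i⟩, fun i => ev_mk (h i)⟩

variable (c R)

theorem exists_zero :
    ∃ z : PresentedEl c R, ∀ i, ev i z = i.obj.obj.zero := by
  obtain ⟨z, hz⟩ := exists_sum (c := c) (R := R) Family.empty fun i => by
    rw [Family.map_empty]
    exact Part.dom_iff_mem.2 ⟨_, i.obj.obj.zero_mem⟩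
  refine ⟨z, fun i => Part.mem_unique (hz i) ?_⟩
  rw [Family.map_empty]
  exact i.obj.obj.zero_mem

end PresentedEl

/-! ### The presented object and its universal property. -/

open WeakSigmaMonoid

/-- The weak `Σ`-monoid presented by generators and relations relative to `SCat c`. -/
noncomputable def presentedObj : WeakSigmaMonoid.{u} :=
  initial (fun i : Interpretation c R => i.obj.obj) PresentedEl.ev PresentedEl.ext
    (PresentedEl.exists_zero c R).choose (PresentedEl.exists_zero c R).choose_spec

theorem presentedObj_isFinitelyTotal
    (h : ∀ i : Interpretation c R, i.obj.obj.IsFinitelyTotal) :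
    (presentedObj c R).IsFinitelyTotal :=
  initial_isFinitelyTotal fun x => PresentedEl.exists_sum (Family.of x) fun i =>
    h i fun k => PresentedEl.ev i (x k)

/-- What each flavour demands beyond the inherited laws is the existence of certain sums or
inverses. These exist in all interpretations, and the constructors `SigmaTerm.sum` and
`SigmaTerm.neg` provide terms for them. -/
theorem presentedObj_prop : c.prop (presentedObj c R) := by
  cases c with
  | weak => trivial
  | strong =>
    refine initial_isStrong (fun i => i.obj.property) fun x a ha S => ?_
    exact PresentedEl.exists_sum (Family.of fun k : S => x k) fun i =>
      i.obj.property.subsummability _ (Part.dom_iff_mem.2 ⟨_, ha i⟩) S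
  | finTotal =>
    exact presentedObj_isFinitelyTotal _ R fun i =>
      @ObjectProperty.FullSubcategory.property _ _ (SigmaKind.prop .finTotal) i.obj
  | group =>
    have hG : ∀ i : Interpretation .group R, i.obj.obj.IsSigmaGroup := fun i => i.obj.property
    choose neg h0 hneg using fun i => (hG i).2
    choose n hn using fun a : PresentedEl .group R =>
      PresentedEl.exists_neg a (fun i => neg i (PresentedEl.ev i a)) fun i => h0 i _
    exact initial_isSigmaGroup (presentedObj_isFinitelyTotal _ R fun i => (hG i).1)
      n neg h0 hneg fun i a => hn a i

/-- The object of `SCat c` presented by generators and relations. -/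
noncomputable def presented : SCat.{u} c := ⟨presentedObj c R, presentedObj_prop c R⟩

variable {c R} in
theorem mem_presented_sum {s : Family (PresentedEl c R)} {a : PresentedEl c R} :
    a ∈ (presented c R).obj.sum s ↔
      ∀ i : Interpretation c R, PresentedEl.ev i a ∈ i.obj.obj.sum (s.map (PresentedEl.ev i)) :=
  mem_initial_sum (hf := PresentedEl.ext) (hz := (PresentedEl.exists_zero c R).choose_spec)

variable {c R} in
theorem isHom_ev (i : Interpretation c R) :
    IsHom (presented c R).obj i.obj.obj (PresentedEl.ev i) :=
  fun _ _ h => mem_presented_sum.1 h i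

/-- The generators of the presented object. -/
noncomputable def presentedGen (a : A) : El (presented c R) :=
  PresentedEl.mk (.gen a) fun i => ⟨i.fn a, rfl⟩

variable {c R} in
theorem ev_presentedGen (i : Interpretation c R) (a : A) :
    PresentedEl.ev i (presentedGen c R a) = i.fn a :=
  PresentedEl.ev_mk (show (SigmaTerm.gen a).Evals i.obj.obj i.fn (i.fn a) from rfl)

theorem respects_presentedGen : Respects R (presented c R).obj (presentedGen c R) := by
  intro s a h
  refine mem_presented_sum.2 fun i => ?_
  have key := i.respects s a h
  rw [← funext (ev_presentedGen i)] at key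
  exact (Family.map_map (PresentedEl.ev i) (presentedGen c R) s).symm ▸ key

variable {c R}

/-- Induction on a term representing the element: homomorphisms preserve sums, and they preserve
inverses because these are unique. The target may be any weak `Σ`-monoid, so the result also applies
to maps leaving `SCat c`. -/
theorem presented_hom_ext {Z : WeakSigmaMonoid.{u}} {f g : El (presented c R) → Z.carrier}
    (hf : IsHom (presented c R).obj Z f) (hg : IsHom (presented c R).obj Z g)
    (h : ∀ a, f (presentedGen c R a) = g (presentedGen c R a)) : f = g := by
  suffices ∀ (t : SigmaTerm A) (a : PresentedEl c R),
      (∀ i, t.Evals i.obj.obj i.fn (PresentedEl.ev i a)) → f a = g a from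
    funext fun a => (PresentedEl.exists_rep a).elim fun t ht => this t a ht
  intro t
  induction t with
  | gen a =>
    intro b hb
    have : b = presentedGen c R a :=
      PresentedEl.ext _ _ fun i => (hb i).trans (ev_presentedGen i a).symm
    rw [this, h]
  | sum I t ih =>
    intro b hb
    choose v hv hs using hb
    -- A sum is defined only if its summands are, so the subterms again represent elements.
    let x : I → PresentedEl c R := fun k => PresentedEl.mk (t k) fun i => ⟨_, hv i k⟩
    have hx : ∀ k i, PresentedEl.ev i (x k) = v i k := fun k i => PresentedEl.ev_mk (hv i k)
    have hb' : b ∈ (presented c R).obj.sum (Family.of x) := mem_presented_sum.2 fun i => by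
      have key := hs i
      rw [← funext fun k => hx k i] at key
      exact key
    refine Part.mem_unique (isHom_iff.1 hf x b hb') ?_
    rw [show (fun k => f (x k)) = fun k => g (x k) from
      funext fun k => ih k (x k) fun i => (hx k i).symm ▸ hv i k]
    exact isHom_iff.1 hg x b hb'
  | neg t ih =>
    intro b hb
    choose y hy hs using hb
    let x : PresentedEl c R := PresentedEl.mk t fun i => ⟨_, hy i⟩
    have hx : ∀ i, PresentedEl.ev i x = y i := fun i => PresentedEl.ev_mk (hy i)
    have hb' : (presented c R).obj.zero ∈ (presented c R).obj.sum (Family.pair x b) := by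
      refine mem_presented_sum.2 fun i => ?_
      have h0 := (isHom_ev i).map_zero
      exact (Family.map_pair (PresentedEl.ev i) x b).symm ▸ h0.symm ▸ (hx i).symm ▸ hs i
    have hf' := hf.map_pair hb'
    have hg' := hg.map_pair hb'
    rw [hf.map_zero] at hf'
    rw [hg.map_zero, ← ih x fun i => (hx i).symm ▸ hy i] at hg'
    exact eq_of_zero_mem_sum_pair hf' hg'

/-- The pair `(Z, f)` is itself an interpretation, and evaluation in it is the lift. -/
theorem exists_presented_lift (Z : SCat.{u} c) (f : A → El Z) (hf : Respects R Z.obj f) :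
    ∃ g : presented c R ⟶ Z, ∀ a, fn g (presentedGen c R a) = f a :=
  ⟨⟨⟨PresentedEl.ev ⟨Z, f, hf⟩, isHom_ev ⟨Z, f, hf⟩⟩⟩, ev_presentedGen ⟨Z, f, hf⟩⟩

end Presentation

end SCat

namespace WeakSigmaMonoid

variable {W X Y Z : WeakSigmaMonoid.{u}}

/-- Only the target determines the flavour: every `SCat c` is an exponential ideal, which is what
makes its reflectors monoidal. -/
theorem internalHom_prop (X : WeakSigmaMonoid.{u}) {c : SigmaKind} (h : c.prop Y) :
    c.prop (internalHom X Y) := by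
  cases c with
  | weak => trivial
  | strong => exact internalHom_isStrong h
  | finTotal => exact internalHom_isFinitelyTotal h
  | group => exact internalHom_isSigmaGroup h

theorem isHom_curry {f : X.carrier → Y.carrier → Z.carrier} (h₁ : ∀ x, IsHom Y Z (f x))
    (h₂ : ∀ y, IsHom X Z fun x => f x y) :
    IsHom X (internalHom Y Z) fun x => (⟨f x, h₁ x⟩ : Hom Y Z) :=
  isHom_initial_iff.2 h₂

theorem IsHom.eval {f : X.carrier → Hom Y Z} (hf : IsHom X (internalHom Y Z) f) (y : Y.carrier) :
    IsHom X Z fun x => (f x).toFun y :=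
  isHom_initial_iff.1 hf y

end WeakSigmaMonoid

namespace SCat

open WeakSigmaMonoid

variable {c : SigmaKind} {W X Y Z : SCat.{u} c}

/-! ### Morphisms -/

theorem hom_ext {f g : X ⟶ Y} (h : ∀ x, fn f x = fn g x) : f = g :=
  ObjectProperty.hom_ext _ (WeakSigmaMonoid.Hom.ext (funext h))

/-- The morphism given by a `Σ`-homomorphism. -/
abbrev homMk (f : El X → El Y) (hf : IsHom X.obj Y.obj f) : X ⟶ Y := ⟨⟨f, hf⟩⟩

theorem isHom_fn (f : X ⟶ Y) : IsHom X.obj Y.obj (fn f) := f.hom.isHom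

@[simp]
theorem fn_comp (f : X ⟶ Y) (g : Y ⟶ Z) (x : El X) : fn (f ≫ g) x = fn g (fn f x) := rfl

@[simp]
theorem fn_id (x : El X) : fn (𝟙 X) x = x := rfl

@[simp]
theorem fn_inv_fn_hom (i : X ≅ Y) (x : El X) : fn i.inv (fn i.hom x) = x := by
  rw [← fn_comp, i.hom_inv_id, fn_id]

theorem isBilinear_mk {f : El X → El Y → El Z} (h₁ : ∀ x, IsHom Y.obj Z.obj (f x))
    (h₂ : ∀ y, IsHom X.obj Z.obj fun x => f x y) : IsBilinear X Y Z f :=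
  ⟨h₁, h₂⟩

/-- The object of `Σ`-homomorphisms from a weak `Σ`-monoid to an object of `SCat c`. -/
noncomputable def homObj (X : WeakSigmaMonoid.{u}) (Y : SCat.{u} c) : SCat.{u} c :=
  ⟨internalHom X Y.obj, internalHom_prop X Y.property⟩

/-! ### The free object on one generator -/

variable (c) in
/-- The monoidal unit of `SCat c`: the object freely generated by one element. -/
noncomputable def unitObj : SCat.{u} c := presented c (A := PUnit.{u + 1}) fun _ _ => False

variable (c) in
/-- The generator of the monoidal unit. -/
noncomputable def unitEl : El (unitObj.{u} c) := presentedGen c _ PUnit.unit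

theorem unitObj_funext {Z : WeakSigmaMonoid.{u}} {f g : El (unitObj.{u} c) → Z.carrier}
    (hf : IsHom (unitObj c).obj Z f) (hg : IsHom (unitObj c).obj Z g)
    (h : f (unitEl c) = g (unitEl c)) : f = g :=
  presented_hom_ext hf hg fun _ => h

theorem exists_unitObj_lift (z : El Z) : ∃ g : unitObj c ⟶ Z, fn g (unitEl c) = z :=
  (exists_presented_lift Z (fun _ => z) fun _ _ h => h.elim).imp fun _ h => h _

/-! ### Tensor products -/

/-- The relations of the tensor product. -/
inductive TensorRel (X Y : SCat.{u} c) : Family (El X × El Y) → El X × El Y → Prop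
  | left (y : El Y) (s : Family (El X)) (x : El X) (h : x ∈ X.obj.sum s) :
      TensorRel X Y (s.map fun x => (x, y)) (x, y)
  | right (x : El X) (s : Family (El Y)) (y : El Y) (h : y ∈ Y.obj.sum s) :
      TensorRel X Y (s.map fun y => (x, y)) (x, y)

/-- The tensor product in `SCat c`. -/
noncomputable def tensor (X Y : SCat.{u} c) : SCat.{u} c := presented c (TensorRel X Y)

/-- The universal bilinear function. -/
noncomputable def tmul (X Y : SCat.{u} c) (x : El X) (y : El Y) : El (tensor X Y) :=
  presentedGen c (TensorRel X Y) (x, y)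

theorem isHom_tmul_right (x : El X) : IsHom Y.obj (tensor X Y).obj fun y => tmul X Y x y :=
  fun s y h => by
    have := respects_presentedGen c (TensorRel X Y) _ _ (.right x s y h)
    rwa [Family.map_map] at this

theorem isHom_tmul_left (y : El Y) : IsHom X.obj (tensor X Y).obj fun x => tmul X Y x y :=
  fun s x h => by
    have := respects_presentedGen c (TensorRel X Y) _ _ (.left y s x h)
    rwa [Family.map_map] at this

theorem tensor_funext {Z : WeakSigmaMonoid.{u}} {f g : El (tensor X Y) → Z.carrier}
    (hf : IsHom (tensor X Y).obj Z f) (hg : IsHom (tensor X Y).obj Z g)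
    (h : ∀ x y, f (tmul X Y x y) = g (tmul X Y x y)) : f = g :=
  presented_hom_ext hf hg fun a => h a.1 a.2

theorem exists_tensor_lift (f : El X → El Y → El Z) (hf : IsBilinear X Y Z f) :
    ∃ g : tensor X Y ⟶ Z, ∀ x y, fn g (tmul X Y x y) = f x y := by
  refine (exists_presented_lift (R := TensorRel X Y) Z (fun a => f a.1 a.2) ?_).imp
    fun g h x y => h (x, y)
  rintro _ _ (⟨y, s, x, h⟩ | ⟨x, s, y, h⟩)
  · rw [Family.map_map]
    exact hf.2 y s x h
  · rw [Family.map_map]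
    exact hf.1 x s y h

theorem isTensorProduct_tensor (X Y : SCat.{u} c) :
    IsTensorProduct X Y (tensor X Y) (tmul X Y) where
  bilinear := ⟨isHom_tmul_right, isHom_tmul_left⟩
  existsUnique Z f hf := by
    obtain ⟨g, hg⟩ := exists_tensor_lift f hf
    refine ⟨g, hg, fun g' hg' => hom_ext fun t => ?_⟩
    exact congrFun (tensor_funext (isHom_fn g') (isHom_fn g) fun x y => (hg' x y).trans
      (hg x y).symm) t

/-- The morphism out of the tensor product induced by a bilinear function. -/
noncomputable def tensorLift (f : El X → El Y → El Z) (hf : IsBilinear X Y Z f) :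
    tensor X Y ⟶ Z := (exists_tensor_lift f hf).choose

@[simp]
theorem tensorLift_tmul (f : El X → El Y → El Z) (hf : IsBilinear X Y Z f) (x : El X) (y : El Y) :
    fn (tensorLift f hf) (tmul X Y x y) = f x y :=
  (exists_tensor_lift f hf).choose_spec x y

theorem tensor_hom_ext {f g : tensor X Y ⟶ Z}
    (h : ∀ x y, fn f (tmul X Y x y) = fn g (tmul X Y x y)) : f = g :=
  hom_ext (congrFun (tensor_funext (isHom_fn f) (isHom_fn g) h))

theorem tensor_funext₃ {Z : SCat.{u} c} {V : WeakSigmaMonoid.{u}}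
    {f g : El (tensor (tensor X Y) Z) → V.carrier}
    (hf : IsHom (tensor (tensor X Y) Z).obj V f) (hg : IsHom (tensor (tensor X Y) Z).obj V g)
    (h : ∀ x y z, f (tmul _ Z (tmul X Y x y) z) = g (tmul _ Z (tmul X Y x y) z)) : f = g :=
  tensor_funext hf hg fun u z => congrFun (tensor_funext (hf.comp (isHom_tmul_left z))
    (hg.comp (isHom_tmul_left z)) fun x y => h x y z) u

theorem tensor_hom_ext₃ {f g : tensor (tensor X Y) Z ⟶ W}
    (h : ∀ x y z, fn f (tmul _ Z (tmul X Y x y) z) = fn g (tmul _ Z (tmul X Y x y) z)) : f = g :=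
  hom_ext (congrFun (tensor_funext₃ (isHom_fn f) (isHom_fn g) h))

theorem tensor_hom_ext₃' {f g : tensor X (tensor Y Z) ⟶ W}
    (h : ∀ x y z, fn f (tmul X _ x (tmul Y Z y z)) = fn g (tmul X _ x (tmul Y Z y z))) : f = g :=
  tensor_hom_ext fun x u => congrFun (tensor_funext ((isHom_fn f).comp (isHom_tmul_right x))
    ((isHom_fn g).comp (isHom_tmul_right x)) fun y z => h x y z) u

/-- The value of an element of the internal hom. -/
def homEval {X : WeakSigmaMonoid.{u}} (f : El (homObj X Y)) : X.carrier → El Y := Hom.toFun f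

theorem isHom_homEval {X : WeakSigmaMonoid.{u}} (f : El (homObj X Y)) : IsHom X Y.obj (homEval f) :=
  Hom.isHom f

theorem isHom_homEval_left {X V : WeakSigmaMonoid.{u}} {g : V.carrier → El (homObj X Y)}
    (hg : IsHom V (homObj X Y).obj g) (x : X.carrier) : IsHom V Y.obj fun v => homEval (g v) x :=
  hg.eval x

/-- The morphism out of the tensor product given by a morphism to the internal hom. -/
noncomputable def uncurry (g : X ⟶ homObj Y.obj Z) : tensor X Y ⟶ Z :=
  tensorLift (fun x y => homEval (fn g x) y)
    (isBilinear_mk (fun x => isHom_homEval (fn g x)) (isHom_homEval_left (isHom_fn g)))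

@[simp]
theorem uncurry_tmul (g : X ⟶ homObj Y.obj Z) (x : El X) (y : El Y) :
    fn (uncurry g) (tmul X Y x y) = homEval (fn g x) y := by
  rw [uncurry, tensorLift_tmul]

/-- A trilinear function extends along the tensor product of the first two arguments. -/
theorem exists_tensor_lift_left (f : El X → El Y → El Z → El W)
    (h₁ : ∀ y z, IsHom X.obj W.obj fun x => f x y z)
    (h₂ : ∀ x z, IsHom Y.obj W.obj fun y => f x y z)
    (h₃ : ∀ x y, IsHom Z.obj W.obj (f x y)) :
    ∃ g : tensor (tensor X Y) Z ⟶ W, ∀ x y z, fn g (tmul _ Z (tmul X Y x y) z) = f x y z := by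
  -- A trilinear function is a bilinear function with values in an internal hom.
  obtain ⟨g, hg⟩ := exists_tensor_lift (Z := homObj Z.obj W)
    (fun x y => (⟨f x y, h₃ x y⟩ : Hom Z.obj W.obj))
    ⟨fun x => isHom_curry (h₃ x) fun z => h₂ x z, fun y => isHom_curry _ fun z => h₁ y z⟩
  exact ⟨uncurry g, fun x y z => (uncurry_tmul _ _ _).trans
    (congrArg (fun h => homEval h z) (hg x y))⟩

/-- A trilinear function extends along the tensor product of the last two arguments. -/
theorem exists_tensor_lift_right (f : El X → El Y → El Z → El W)
    (h₁ : ∀ y z, IsHom X.obj W.obj fun x => f x y z)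
    (h₂ : ∀ x z, IsHom Y.obj W.obj fun y => f x y z)
    (h₃ : ∀ x y, IsHom Z.obj W.obj (f x y)) :
    ∃ g : tensor X (tensor Y Z) ⟶ W, ∀ x y z, fn g (tmul X _ x (tmul Y Z y z)) = f x y z := by
  obtain ⟨g, hg⟩ := exists_tensor_lift (Z := homObj X.obj W)
    (fun y z => (⟨fun x => f x y z, h₁ y z⟩ : Hom X.obj W.obj))
    ⟨fun y => isHom_curry (h₁ y) fun x => h₃ x y, fun z => isHom_curry (fun y => h₁ y z)
      fun x => h₂ x z⟩
  refine ⟨tensorLift (fun x u => homEval (fn g u) x)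
    (isBilinear_mk (isHom_homEval_left (isHom_fn g)) fun u => isHom_homEval (fn g u)), fun x y z => ?_⟩
  rw [tensorLift_tmul]
  exact congrArg (fun h => homEval h x) (hg y z)

/-! ### Structure morphisms -/

theorem exists_assoc (X Y Z : SCat.{u} c) :
    ∃ i : tensor (tensor X Y) Z ≅ tensor X (tensor Y Z),
      ∀ x y z, fn i.hom (tmul _ Z (tmul X Y x y) z) = tmul X _ x (tmul Y Z y z) := by
  obtain ⟨f, hf⟩ := exists_tensor_lift_left
    (fun x y z => tmul X (tensor Y Z) x (tmul Y Z y z)) (fun y z => isHom_tmul_left _)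
    (fun x z => (isHom_tmul_right x).comp (isHom_tmul_left z))
    fun x y => (isHom_tmul_right x).comp (isHom_tmul_right y)
  obtain ⟨g, hg⟩ := exists_tensor_lift_right
    (fun x y z => tmul (tensor X Y) Z (tmul X Y x y) z)
    (fun y z => (isHom_tmul_left z).comp (isHom_tmul_left y))
    (fun x z => (isHom_tmul_left z).comp (isHom_tmul_right x)) fun x y => isHom_tmul_right _
  exact ⟨⟨f, g, tensor_hom_ext₃ fun x y z => by simp only [fn_comp, fn_id, hf, hg],
    tensor_hom_ext₃' fun x y z => by simp only [fn_comp, fn_id, hf, hg]⟩, hf⟩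

/-- The forward map is the uncurried morphism that sends the free generator to the identity in the
internal hom of `X`; its inverse is `x ↦ 1 ⊗ x`. -/
theorem exists_leftUnitor (X : SCat.{u} c) :
    ∃ i : tensor (unitObj c) X ≅ X, ∀ x, fn i.hom (tmul _ X (unitEl c) x) = x := by
  obtain ⟨g, hg⟩ := exists_unitObj_lift (Z := homObj X.obj X) (⟨fun x => x, isHom_id⟩ : Hom _ _)
  have key : ∀ x, fn (uncurry g) (tmul _ X (unitEl c) x) = x := fun x =>
    (uncurry_tmul _ _ _).trans (congrArg (fun h => homEval h x) hg)
  refine ⟨⟨_, homMk _ (isHom_tmul_right (unitEl c)), tensor_hom_ext fun u x => ?_, hom_ext key⟩,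
    key⟩
  exact congrFun (unitObj_funext
    ((isHom_tmul_right _).comp ((isHom_fn (uncurry g)).comp (isHom_tmul_left x)))
    (isHom_tmul_left x) (congrArg (tmul _ X _) (key x))) u

theorem exists_braiding (X Y : SCat.{u} c) :
    ∃ i : tensor X Y ≅ tensor Y X, ∀ x y, fn i.hom (tmul X Y x y) = tmul Y X y x := by
  have h : ∀ X Y : SCat.{u} c, IsBilinear X Y (tensor Y X) fun x y => tmul Y X y x :=
    fun X Y => ⟨isHom_tmul_left, isHom_tmul_right⟩
  exact ⟨⟨tensorLift _ (h X Y), tensorLift _ (h Y X), tensor_hom_ext fun x y => by simp,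
    tensor_hom_ext fun x y => by simp⟩, tensorLift_tmul _ (h X Y)⟩

theorem exists_rightUnitor (X : SCat.{u} c) :
    ∃ i : tensor X (unitObj c) ≅ X, ∀ x, fn i.hom (tmul X _ x (unitEl c)) = x := by
  obtain ⟨i, hi⟩ := exists_braiding X (unitObj c)
  obtain ⟨j, hj⟩ := exists_leftUnitor X
  exact ⟨i ≪≫ j, fun x => by rw [Iso.trans_hom, fn_comp, hi, hj]⟩

/-- The tensor product of morphisms. -/
noncomputable def tensorMap (f : X ⟶ Z) (g : Y ⟶ W) : tensor X Y ⟶ tensor Z W :=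
  tensorLift (fun x y => tmul Z W (fn f x) (fn g y))
    (isBilinear_mk (fun _ => (isHom_tmul_right _).comp (isHom_fn g))
      fun _ => (isHom_tmul_left _).comp (isHom_fn f))

@[simp]
theorem tensorMap_tmul (f : X ⟶ Z) (g : Y ⟶ W) (x : El X) (y : El Y) :
    fn (tensorMap f g) (tmul X Y x y) = tmul Z W (fn f x) (fn g y) := by
  rw [tensorMap, tensorLift_tmul]

variable (c) in
/-- The data of the monoidal structure. -/
noncomputable abbrev monoidalStruct : MonoidalCategoryStruct (SCat.{u} c) where
  tensorObj := tensor
  tensorHom := tensorMap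
  whiskerLeft X _ _ f := tensorMap (𝟙 X) f
  whiskerRight f Y := tensorMap f (𝟙 Y)
  tensorUnit := unitObj c
  associator X Y Z := (exists_assoc X Y Z).choose
  leftUnitor X := (exists_leftUnitor X).choose
  rightUnitor X := (exists_rightUnitor X).choose

/-! ### Coherence of the monoidal structure, tested on pure tensors. -/

section

attribute [local instance] monoidalStruct

@[simp]
theorem tensorHom_tmul (f : X ⟶ Z) (g : Y ⟶ W) (x : El X) (y : El Y) :
    fn (f ⊗ₘ g) (tmul X Y x y) = tmul Z W (fn f x) (fn g y) :=
  tensorMap_tmul _ _ _ _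

@[simp]
theorem whiskerLeft_tmul (X : SCat.{u} c) (g : Y ⟶ W) (x : El X) (y : El Y) :
    fn (X ◁ g) (tmul X Y x y) = tmul X W x (fn g y) :=
  tensorMap_tmul _ _ _ _

@[simp]
theorem whiskerRight_tmul (f : X ⟶ Z) (Y : SCat.{u} c) (x : El X) (y : El Y) :
    fn (f ▷ Y) (tmul X Y x y) = tmul Z Y (fn f x) y :=
  tensorMap_tmul _ _ _ _

@[simp]
theorem associator_tmul (x : El X) (y : El Y) (z : El Z) :
    fn (α_ X Y Z).hom (tmul (X ⊗ Y) Z (tmul X Y x y) z) = tmul X (Y ⊗ Z) x (tmul Y Z y z) :=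
  (exists_assoc X Y Z).choose_spec x y z

@[simp]
theorem associator_inv_tmul (x : El X) (y : El Y) (z : El Z) :
    fn (α_ X Y Z).inv (tmul X (Y ⊗ Z) x (tmul Y Z y z)) = tmul (X ⊗ Y) Z (tmul X Y x y) z := by
  rw [← associator_tmul, fn_inv_fn_hom]

@[simp]
theorem leftUnitor_tmul (x : El X) : fn (λ_ X).hom (tmul (𝟙_ _) X (unitEl c) x) = x :=
  (exists_leftUnitor X).choose_spec x

@[simp]
theorem rightUnitor_tmul (x : El X) : fn (ρ_ X).hom (tmul X (𝟙_ _) x (unitEl c)) = x :=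
  (exists_rightUnitor X).choose_spec x

theorem tensorObj_hom_ext {f g : X ⊗ Y ⟶ Z}
    (h : ∀ x y, fn f (tmul X Y x y) = fn g (tmul X Y x y)) : f = g :=
  tensor_hom_ext h

theorem tensorObj_hom_ext₃ {f g : (X ⊗ Y) ⊗ Z ⟶ W}
    (h : ∀ x y z, fn f (tmul (X ⊗ Y) Z (tmul X Y x y) z) =
      fn g (tmul (X ⊗ Y) Z (tmul X Y x y) z)) : f = g :=
  tensor_hom_ext₃ h

theorem tensorObj_hom_ext₃' {f g : X ⊗ Y ⊗ Z ⟶ W}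
    (h : ∀ x y z, fn f (tmul X (Y ⊗ Z) x (tmul Y Z y z)) =
      fn g (tmul X (Y ⊗ Z) x (tmul Y Z y z))) : f = g :=
  tensor_hom_ext₃' h

theorem tensorObj_hom_ext₄ {V : SCat.{u} c} {f g : ((X ⊗ Y) ⊗ Z) ⊗ W ⟶ V}
    (h : ∀ x y z w, fn f (tmul ((X ⊗ Y) ⊗ Z) W (tmul (X ⊗ Y) Z (tmul X Y x y) z) w) =
      fn g (tmul ((X ⊗ Y) ⊗ Z) W (tmul (X ⊗ Y) Z (tmul X Y x y) z) w)) : f = g :=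
  tensor_hom_ext fun u w => congrFun (tensor_funext₃ ((isHom_fn f).comp (isHom_tmul_left w))
    ((isHom_fn g).comp (isHom_tmul_left w)) fun x y z => h x y z w) u

theorem leftUnit_hom_ext {f g : 𝟙_ (SCat.{u} c) ⊗ X ⟶ Y}
    (h : ∀ x, fn f (tmul (𝟙_ _) X (unitEl c) x) = fn g (tmul (𝟙_ _) X (unitEl c) x)) : f = g :=
  tensor_hom_ext fun u x => congrFun (unitObj_funext ((isHom_fn f).comp (isHom_tmul_left x))
    ((isHom_fn g).comp (isHom_tmul_left x)) (h x)) u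

theorem rightUnit_hom_ext {f g : X ⊗ 𝟙_ (SCat.{u} c) ⟶ Y}
    (h : ∀ x, fn f (tmul X (𝟙_ _) x (unitEl c)) = fn g (tmul X (𝟙_ _) x (unitEl c))) : f = g :=
  tensor_hom_ext fun x u => congrFun (unitObj_funext ((isHom_fn f).comp (isHom_tmul_right x))
    ((isHom_fn g).comp (isHom_tmul_right x)) (h x)) u

theorem middleUnit_hom_ext {f g : (X ⊗ 𝟙_ (SCat.{u} c)) ⊗ Y ⟶ Z}
    (h : ∀ x y, fn f (tmul (X ⊗ 𝟙_ _) Y (tmul X (𝟙_ _) x (unitEl c)) y) =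
      fn g (tmul (X ⊗ 𝟙_ _) Y (tmul X (𝟙_ _) x (unitEl c)) y)) : f = g :=
  tensor_hom_ext₃ fun x u y => congrFun (unitObj_funext
    ((isHom_fn f).comp ((isHom_tmul_left y).comp (isHom_tmul_right x)))
    ((isHom_fn g).comp ((isHom_tmul_left y).comp (isHom_tmul_right x))) (h x y)) u

variable (c) in
/-- The monoidal structure of `SCat c`. -/
noncomputable abbrev monoidal : MonoidalCategory (SCat.{u} c) :=
  MonoidalCategory.ofTensorHom
    (id_tensorHom_id := fun X Y => tensorObj_hom_ext fun x y => by simp)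
    (id_tensorHom := fun X Y Z f => rfl)
    (tensorHom_id := fun f Y => rfl)
    (tensorHom_comp_tensorHom := fun f₁ f₂ g₁ g₂ => tensorObj_hom_ext fun x y => by simp)
    (associator_naturality := fun f₁ f₂ f₃ => tensorObj_hom_ext₃ fun x y z => by simp)
    (leftUnitor_naturality := fun f => leftUnit_hom_ext fun x => by simp)
    (rightUnitor_naturality := fun f => rightUnit_hom_ext fun x => by simp)
    (pentagon := fun W X Y Z => tensorObj_hom_ext₄ fun w x y z => by simp)
    (triangle := fun X Y => middleUnit_hom_ext fun x y => by simp)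

end

/-! ### The symmetry. -/

section

attribute [local instance] monoidal

/-- The braiding of the tensor product. -/
noncomputable def braidingIso (X Y : SCat.{u} c) : X ⊗ Y ≅ Y ⊗ X := (exists_braiding X Y).choose

@[simp]
theorem braidingIso_tmul (x : El X) (y : El Y) :
    fn (braidingIso X Y).hom (tmul X Y x y) = tmul Y X y x :=
  (exists_braiding X Y).choose_spec x y

variable (c) in
/-- The symmetric structure of `SCat c`. -/
noncomputable abbrev symmetric : SymmetricCategory (SCat.{u} c) where
  braiding := braidingIso
  braiding_naturality_right X Y Z f := tensorObj_hom_ext fun x y => by simp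
  braiding_naturality_left f Z := tensorObj_hom_ext fun x y => by simp
  hexagon_forward X Y Z := tensorObj_hom_ext₃ fun x y z => by simp
  hexagon_reverse X Y Z := tensorObj_hom_ext₃' fun x y z => by simp
  symmetry X Y := tensorObj_hom_ext fun x y => by simp

end

end SCat

namespace SCat

open WeakSigmaMonoid

variable {c d : SigmaKind}

section

attribute [local instance] monoidal symmetric

theorem isTensorMonoidal (c : SigmaKind) :
    IsTensorMonoidal (c := c) (fun X Y => tmul X Y) (unitEl.{u} c) where
  isTensorProduct := isTensorProduct_tensor
  tensorHom := tensorHom_tmul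
  associator _ _ _ := associator_tmul
  leftUnitor _ := leftUnitor_tmul
  rightUnitor _ := rightUnitor_tmul
  braiding _ _ := braidingIso_tmul

/-! ### Closedness -/

/-- Currying of morphisms. -/
noncomputable def curryEquiv (X Y Z : SCat.{u} c) :
    ((tensorLeft X).obj Y ⟶ Z) ≃ (Y ⟶ homObj X.obj Z) where
  toFun g := homMk _ (isHom_curry (f := fun y x => fn g (tmul X Y x y))
    (fun y => (isHom_fn g).comp (isHom_tmul_left y)) fun x => (isHom_fn g).comp (isHom_tmul_right x))
  invFun k := tensorLift (fun x y => homEval (fn k y) x)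
    (isBilinear_mk (isHom_homEval_left (isHom_fn k)) fun y => isHom_homEval (fn k y))
  left_inv _ := tensor_hom_ext fun x y => tensorLift_tmul _ _ x y
  right_inv _ := hom_ext fun y => WeakSigmaMonoid.Hom.ext (funext fun x => tensorLift_tmul _ _ x y)

theorem nonempty_monoidalClosed (c : SigmaKind) : Nonempty (MonoidalClosed (SCat.{u} c)) :=
  ⟨⟨fun X => ⟨_, Adjunction.adjunctionOfEquivRight (curryEquiv X) fun _ _ _ f g =>
    hom_ext fun y => WeakSigmaMonoid.Hom.ext (funext fun x =>
      congrArg (fn g) (whiskerLeft_tmul X f x y))⟩⟩⟩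

/-! ### Reflections -/

/-- The reflection of an object of `SCat d` in `SCat c`. -/
noncomputable def reflection (c : SigmaKind) (X : SCat.{u} d) : SCat.{u} c :=
  presented c fun s a => a ∈ X.obj.sum s

/-- The universal property of the reflection. -/
noncomputable def reflectionEquiv (h : SigmaKind.prop.{u} c ≤ SigmaKind.prop.{u} d)
    (X : SCat.{u} d) (Y : SCat.{u} c) : (reflection c X ⟶ Y) ≃ (X ⟶ (emb h).obj Y) :=
  Equiv.ofBijective
    (fun g => homMk (Y := (emb h).obj Y) 
      (fun x => fn (c := c) (Y := Y) g (presentedGen c (fun s a => a ∈ X.obj.sum s) x))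
      ((isHom_fn g).comp (Y := (reflection c X).obj)
        -- For these relations, `Respects` unfolds to the definition of a `Σ`-homomorphism.
        (respects_presentedGen c fun s a => a ∈ X.obj.sum s)))
    ⟨fun g g' hg => hom_ext (congrFun (presented_hom_ext (isHom_fn g) (isHom_fn g') fun a =>
      congrArg (fun k => fn k a) hg)), fun k => by
      obtain ⟨g, hg⟩ := exists_presented_lift (R := fun s a => a ∈ X.obj.sum s) Y (fn k)
        (isHom_fn k)
      exact ⟨g, hom_ext hg⟩⟩

theorem emb_isRightAdjoint (h : SigmaKind.prop.{u} c ≤ SigmaKind.prop.{u} d) :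
    (emb h).IsRightAdjoint :=
  (Adjunction.adjunctionOfEquivLeft (reflectionEquiv h) fun _ _ _ _ _ => rfl).isRightAdjoint

variable {h : SigmaKind.prop.{u} c ≤ SigmaKind.prop.{u} d} {F : SCat.{u} d ⥤ SCat.{u} c}
  (adj : F ⊣ emb h)

theorem isHom_unitFn (X : SCat.{u} d) : IsHom X.obj (F.obj X).obj (unitFn adj X) :=
  isHom_fn (adj.unit.app X)

@[simp]
theorem map_unitFn {X Y : SCat.{u} d} (f : X ⟶ Y) (x : El X) :
    fn (F.map f) (unitFn adj X x) = unitFn adj Y (fn f x) :=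
  (congrArg (fun k => fn k x) (adj.unit.naturality f)).symm

theorem reflect_hom_ext {X : SCat.{u} d} {Z : SCat.{u} c} {f g : F.obj X ⟶ Z}
    (hfg : ∀ x, fn f (unitFn adj X x) = fn g (unitFn adj X x)) : f = g :=
  (adj.homEquiv X Z).injective (by
    rw [adj.homEquiv_unit, adj.homEquiv_unit]
    exact hom_ext hfg)

theorem reflect_funext {X : SCat.{u} d} {Z : SCat.{u} c} {f g : El (F.obj X) → El Z}
    (hf : IsHom (F.obj X).obj Z.obj f) (hg : IsHom (F.obj X).obj Z.obj g)
    (hfg : ∀ x, f (unitFn adj X x) = g (unitFn adj X x)) : f = g :=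
  congrArg fn (reflect_hom_ext adj (f := homMk f hf) (g := homMk g hg) hfg)

theorem exists_reflect_lift {X : SCat.{u} d} {Z : SCat.{u} c} (f : El X → El Z)
    (hf : IsHom X.obj Z.obj f) : ∃ g : F.obj X ⟶ Z, ∀ x, fn g (unitFn adj X x) = f x := by
  obtain ⟨g, hg⟩ := (adj.homEquiv X Z).surjective (homMk (Y := (emb h).obj Z) f hf)
  rw [adj.homEquiv_unit] at hg
  exact ⟨g, fun x => congrArg (fun k => fn k x) hg⟩

/-! ### The unit -/

/-- The function on `{0, 1}` mapping `1` to `z` and `0` to the neutral element. -/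
noncomputable def unitLift (Z : WeakSigmaMonoid.{u}) (z : Z.carrier) (n : ULift.{u} (Fin 2)) :
    Z.carrier :=
  if n.down = 1 then z else Z.zero

theorem unitLift_one (Z : WeakSigmaMonoid.{u}) (z : Z.carrier) : unitLift Z z ⟨1⟩ = z := if_pos rfl

theorem unitLift_of_ne (Z : WeakSigmaMonoid.{u}) (z : Z.carrier) {n : ULift.{u} (Fin 2)}
    (hn : n ≠ ⟨1⟩) : unitLift Z z n = Z.zero :=
  if_neg fun h => hn (ULift.ext _ _ h)

theorem isHom_unitLift (Z : WeakSigmaMonoid.{u}) (z : Z.carrier) :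
    IsHom WeakSigmaMonoid.unit Z (unitLift Z z) := by
  refine isHom_iff.2 fun {ι} _ n a ha => ?_
  rcases (mem_unitSum_of n a).1 ha with ⟨rfl, h0⟩ | ⟨rfl, j, hj, h1⟩
  · rw [unitLift_of_ne Z z (by simp), funext fun i => unitLift_of_ne Z z fun hi => h0 ⟨i, hi⟩]
    exact zero_mem_sum_zero Z ι
  · have := mem_sum_of_eq_zero (X := Z) (x := fun i => unitLift Z z (n i)) j
      fun i hi => unitLift_of_ne Z z fun h => hi (h1 i h)
    exact hj ▸ this

theorem exists_unit_iso : ∃ i : 𝟙_ (SCat.{u} .weak) ≅ unit.{u},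
    fn i.hom (unitEl .weak) = ULift.up 1 := by
  obtain ⟨g, hg⟩ := exists_unitObj_lift (Z := unit.{u}) (ULift.up (1 : Fin 2))
  let k : unit.{u} ⟶ unitObj .weak := homMk _ (isHom_unitLift _ (unitEl .weak))
  have hk : fn k (ULift.up (1 : Fin 2)) = unitEl .weak := unitLift_one _ _
  refine ⟨⟨g, k, hom_ext fun x => congrFun (unitObj_funext (isHom_fn (g ≫ k))
    (isHom_fn (𝟙 _)) ?_) x, hom_ext fun n => ?_⟩, hg⟩
  · rw [fn_comp, hg, hk, fn_id]
  · obtain ⟨n⟩ := n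
    change fn g (fn k ⟨n⟩) = ⟨n⟩
    fin_cases n
    · have h0 : fn (k ≫ g) unit.obj.zero = unit.obj.zero := (isHom_fn (k ≫ g)).map_zero
      -- The neutral element is extracted by choice, so it is recognised as `0` through the
      -- uniqueness of the empty sum.
      have : unit.obj.zero = (ULift.up 0 : ULift.{u} (Fin 2)) :=
        Part.mem_unique unit.obj.zero_mem ((mem_unitSum_of _ _).2 (Or.inl ⟨rfl, by simp⟩))
      rw [this] at h0
      exact h0
    · exact (congrArg (fn g) hk).trans hg

/-- By adjunction, the reflection of a free object on one generator is again free on one generator.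
-/
theorem exists_unit_reflect_iso : ∃ i : 𝟙_ (SCat.{u} c) ≅ F.obj (𝟙_ (SCat.{u} d)),
    fn i.hom (unitEl c) = unitFn adj (𝟙_ (SCat.{u} d)) (unitEl d) := by
  obtain ⟨f, hf⟩ := exists_unitObj_lift (unitFn adj (𝟙_ (SCat.{u} d)) (unitEl d))
  obtain ⟨k, hk⟩ := exists_unitObj_lift (Z := (emb h).obj (unitObj c)) (unitEl c)
  obtain ⟨g, hg⟩ := exists_reflect_lift adj (Z := unitObj c) (fn k) (isHom_fn k)
  refine ⟨⟨f, g, hom_ext (congrFun (unitObj_funext (isHom_fn (f ≫ g)) (isHom_fn (𝟙 _)) ?_)),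
    reflect_hom_ext adj (congrFun (unitObj_funext ((isHom_fn (g ≫ f)).comp (isHom_unitFn adj _))
      (isHom_unitFn adj _) ?_))⟩, hf⟩
  · rw [fn_comp, hf, fn_id]
    exact (hg _).trans hk
  · rw [fn_comp]
    exact (congrArg (fn f) ((hg _).trans hk)).trans hf

/-! ### Reflections and tensor products -/

/-- Bilinearity does not depend on the ambient category, so both sides classify bilinear functions
from `X × Y` to objects of `SCat c`. -/
theorem exists_tensor_iso_reflect (X Y : SCat.{u} c) :
    ∃ i : X ⊗ Y ≅ F.obj ((emb h).obj X ⊗ (emb h).obj Y), ∀ (x : El X) (y : El Y),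
      fn i.hom (tmul X Y x y) =
        unitFn adj _ (tmul ((emb h).obj X) ((emb h).obj Y) x y) := by
  obtain ⟨f, hf⟩ := exists_tensor_lift (X := X) (Y := Y)
    (fun x y => unitFn adj _ (tmul ((emb h).obj X) ((emb h).obj Y) x y))
    (isBilinear_mk (fun x => (isHom_unitFn adj _).comp
        (isHom_tmul_right (X := (emb h).obj X) (Y := (emb h).obj Y) x))
      fun y => (isHom_unitFn adj _).comp
        (isHom_tmul_left (X := (emb h).obj X) (Y := (emb h).obj Y) y))
  obtain ⟨k, hk⟩ := exists_tensor_lift (X := (emb h).obj X) (Y := (emb h).obj Y)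
    (Z := (emb h).obj (X ⊗ Y)) (fun x y => tmul X Y x y)
    (isBilinear_mk (isHom_tmul_right (X := X)) (isHom_tmul_left (Y := Y)))
  obtain ⟨g, hg⟩ := exists_reflect_lift adj (Z := X ⊗ Y) (fn k) (isHom_fn k)
  refine ⟨⟨f, g, tensorObj_hom_ext fun x y => ?_, reflect_hom_ext adj (congrFun (tensor_funext
    ((isHom_fn (g ≫ f)).comp (isHom_unitFn adj _)) (isHom_unitFn adj _) fun x y => ?_))⟩, hf⟩
  · exact (congrArg (fn g) (hf x y)).trans ((hg _).trans (hk x y))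
  · exact (congrArg (fn f) ((hg _).trans (hk x y))).trans (hf x y)

theorem reflect_tensor_funext {X Y : SCat.{u} d} {Z : SCat.{u} c}
    {f g : El (F.obj X ⊗ F.obj Y) → El Z} (hf : IsHom (F.obj X ⊗ F.obj Y).obj Z.obj f)
    (hg : IsHom (F.obj X ⊗ F.obj Y).obj Z.obj g)
    (hfg : ∀ x y, f (tmul (F.obj X) (F.obj Y) (unitFn adj X x) (unitFn adj Y y)) =
      g (tmul (F.obj X) (F.obj Y) (unitFn adj X x) (unitFn adj Y y))) : f = g := by
  refine tensor_funext hf hg fun x y => ?_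
  refine congrFun (reflect_funext adj (hf.comp (isHom_tmul_left y)) (hg.comp (isHom_tmul_left y))
    fun x => ?_) x
  exact congrFun (reflect_funext adj (hf.comp (isHom_tmul_right _)) (hg.comp (isHom_tmul_right _))
    fun y => hfg x y) y

theorem reflect_tensor_hom_ext {X Y : SCat.{u} d} {Z : SCat.{u} c} {f g : F.obj X ⊗ F.obj Y ⟶ Z}
    (hfg : ∀ x y, fn f (tmul (F.obj X) (F.obj Y) (unitFn adj X x) (unitFn adj Y y)) =
      fn g (tmul (F.obj X) (F.obj Y) (unitFn adj X x) (unitFn adj Y y))) : f = g :=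
  hom_ext (congrFun (reflect_tensor_funext adj (isHom_fn f) (isHom_fn g) hfg))

theorem reflect_tensor_hom_ext₃ {W X Y : SCat.{u} d} {Z : SCat.{u} c}
    {f g : (F.obj W ⊗ F.obj X) ⊗ F.obj Y ⟶ Z}
    (hfg : ∀ w x y, fn f (tmul (F.obj W ⊗ F.obj X) (F.obj Y)
        (tmul (F.obj W) (F.obj X) (unitFn adj W w) (unitFn adj X x)) (unitFn adj Y y)) =
      fn g (tmul (F.obj W ⊗ F.obj X) (F.obj Y)
        (tmul (F.obj W) (F.obj X) (unitFn adj W w) (unitFn adj X x)) (unitFn adj Y y))) :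
    f = g := by
  refine tensorObj_hom_ext fun u y => ?_
  refine congrFun (reflect_funext adj ((isHom_fn f).comp (isHom_tmul_right u))
    ((isHom_fn g).comp (isHom_tmul_right u)) fun y => ?_) y
  exact congrFun (reflect_tensor_funext adj ((isHom_fn f).comp (isHom_tmul_left _))
    ((isHom_fn g).comp (isHom_tmul_left _)) fun w x => hfg w x y) u

/-- The variables are extended along the adjunction unit one at a time. The internal hom from `Y` to
`Z` lies in `SCat c` although `Y` may not, so `X` can be replaced by `F X`; after swapping the
variables, `Y` is replaced likewise. -/
theorem exists_reflect_tensor_lift {X Y : SCat.{u} d} {Z : SCat.{u} c} (f : El X → El Y → El Z)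
    (h₁ : ∀ x, IsHom Y.obj Z.obj (f x)) (h₂ : ∀ y, IsHom X.obj Z.obj fun x => f x y) :
    ∃ g : F.obj X ⊗ F.obj Y ⟶ Z,
      ∀ x y, fn g (tmul (F.obj X) (F.obj Y) (unitFn adj X x) (unitFn adj Y y)) = f x y := by
  obtain ⟨k, hk⟩ := exists_reflect_lift adj (Z := homObj Y.obj Z) _ (isHom_curry h₁ h₂)
  obtain ⟨l, hl⟩ := exists_reflect_lift adj (Z := homObj (F.obj X).obj Z) _
    (isHom_curry (f := fun y u => homEval (fn k u) y) (isHom_homEval_left (isHom_fn k))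
      fun u => isHom_homEval (fn k u))
  refine ⟨tensorLift (fun u v => homEval (fn l v) u)
    (isBilinear_mk (isHom_homEval_left (isHom_fn l)) fun v => isHom_homEval (fn l v)),
    fun x y => (tensorLift_tmul _ _ _ _).trans ?_⟩
  exact (congrArg (fun r => homEval r (unitFn adj X x)) (hl y)).trans
    (congrArg (fun r => homEval r y) (hk x))

/-- Both sides classify bilinear functions from `X × Y` to objects of `SCat c`. -/
theorem exists_reflect_tensor_iso (X Y : SCat.{u} d) :
    ∃ i : F.obj X ⊗ F.obj Y ≅ F.obj (X ⊗ Y), ∀ (x : El X) (y : El Y),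
      fn i.hom (tmul (F.obj X) (F.obj Y) (unitFn adj X x) (unitFn adj Y y)) =
        unitFn adj (X ⊗ Y) (tmul X Y x y) := by
  obtain ⟨f, hf⟩ := exists_reflect_tensor_lift adj (X := X) (Y := Y)
    (fun x y => unitFn adj (X ⊗ Y) (tmul X Y x y))
    (fun x => (isHom_unitFn adj _).comp (isHom_tmul_right x))
    fun y => (isHom_unitFn adj _).comp (isHom_tmul_left y)
  obtain ⟨k, hk⟩ := exists_tensor_lift (X := X) (Y := Y) (Z := (emb h).obj (F.obj X ⊗ F.obj Y))
    (fun x y => tmul (F.obj X) (F.obj Y) (unitFn adj X x) (unitFn adj Y y))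
    (isBilinear_mk
      (fun _ => (isHom_tmul_right (X := F.obj X) (Y := F.obj Y) _).comp (isHom_unitFn adj Y))
      fun _ => (isHom_tmul_left (X := F.obj X) (Y := F.obj Y) _).comp (isHom_unitFn adj X))
  obtain ⟨g, hg⟩ := exists_reflect_lift adj (Z := F.obj X ⊗ F.obj Y) (fn k) (isHom_fn k)
  refine ⟨⟨f, g, reflect_tensor_hom_ext adj fun x y => ?_, reflect_hom_ext adj (congrFun
    (tensor_funext ((isHom_fn (g ≫ f)).comp (isHom_unitFn adj _)) (isHom_unitFn adj _)
      fun x y => ?_))⟩, hf⟩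
  · exact (congrArg (fn g) (hf x y)).trans ((hg _).trans (hk x y))
  · exact (congrArg (fn f) ((hg _).trans (hk x y))).trans (hf x y)

/-- The canonical isomorphism `F X ⊗ F Y ≅ F (X ⊗ Y)`. -/
noncomputable def reflectTensorIso (X Y : SCat.{u} d) : F.obj X ⊗ F.obj Y ≅ F.obj (X ⊗ Y) :=
  (exists_reflect_tensor_iso adj X Y).choose

@[simp]
theorem reflectTensorIso_tmul {X Y : SCat.{u} d} (x : El X) (y : El Y) :
    fn (reflectTensorIso adj X Y).hom
      (tmul (F.obj X) (F.obj Y) (unitFn adj X x) (unitFn adj Y y)) =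
        unitFn adj (X ⊗ Y) (tmul X Y x y) :=
  (exists_reflect_tensor_iso adj X Y).choose_spec x y

/-- The canonical isomorphism between the unit and the reflection of the unit. -/
noncomputable def reflectUnitIso : 𝟙_ (SCat.{u} c) ≅ F.obj (𝟙_ (SCat.{u} d)) :=
  (exists_unit_reflect_iso adj).choose

@[simp]
theorem reflectUnitIso_unitEl : fn (reflectUnitIso adj).hom (unitEl c) =
    unitFn adj (𝟙_ (SCat.{u} d)) (unitEl d) :=
  (exists_unit_reflect_iso adj).choose_spec

/-- The reflector is strong monoidal. -/
noncomputable def reflectCoreMonoidal : F.CoreMonoidal where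
  εIso := reflectUnitIso adj
  μIso := reflectTensorIso adj
  μIso_hom_natural_left f X' := reflect_tensor_hom_ext adj fun x y => by simp
  μIso_hom_natural_right X' f := reflect_tensor_hom_ext adj fun x y => by simp
  associativity X Y Z := reflect_tensor_hom_ext₃ adj fun x y z => by simp
  left_unitality X := leftUnit_hom_ext fun x => congrFun (reflect_funext adj
    ((isHom_fn _).comp (isHom_tmul_right _)) ((isHom_fn _).comp (isHom_tmul_right _))
    fun x => by simp) x
  right_unitality X := rightUnit_hom_ext fun x => congrFun (reflect_funext adj
    ((isHom_fn _).comp (isHom_tmul_left _)) ((isHom_fn _).comp (isHom_tmul_left _))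
    fun x => by simp) x

theorem exists_braided : ∃ _ : F.Braided,
    fn (Functor.LaxMonoidal.ε F) (unitEl c) = unitFn adj (𝟙_ (SCat.{u} d)) (unitEl d) ∧
    ∀ (X Y : SCat.{u} d) (x : El X) (y : El Y),
      fn (Functor.LaxMonoidal.μ F X Y)
          (tmul (F.obj X) (F.obj Y) (unitFn adj X x) (unitFn adj Y y)) =
        unitFn adj (X ⊗ Y) (tmul X Y x y) := by
  let _ := (reflectCoreMonoidal adj).toMonoidal
  refine ⟨{ braided := fun X Y => ?_ }, ?_, ?_⟩
  · refine reflect_tensor_hom_ext adj fun x y => ?_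
    change fn (F.map (braidingIso X Y).hom) (fn (reflectTensorIso adj X Y).hom _) =
      fn (reflectTensorIso adj Y X).hom (fn (braidingIso (F.obj X) (F.obj Y)).hom _)
    simp
  · exact reflectUnitIso_unitEl adj
  · exact fun X Y => reflectTensorIso_tmul adj

theorem exists_unit_iso_reflect {F : SCat.{u} .weak ⥤ SCat.{u} c} (adj : F ⊣ toWeak c) :
    ∃ i : 𝟙_ (SCat.{u} c) ≅ F.obj unit.{u},
      fn i.hom (unitEl c) = unitFn adj unit.{u} (ULift.up 1) := by
  obtain ⟨i, hi⟩ := exists_unit_iso.{u}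
  refine ⟨reflectUnitIso adj ≪≫ F.mapIso i, ?_⟩
  rw [Iso.trans_hom, fn_comp, reflectUnitIso_unitEl, Functor.mapIso_hom, map_unitFn, hi]

end

end SCat

theorem mainTheorem2 :
    -- every embedding between two of the four categories has a left adjoint
    (∀ (c d : SigmaKind) (h : SigmaKind.prop.{u} c ≤ SigmaKind.prop.{u} d),
      (SCat.emb h).IsRightAdjoint) ∧
    -- the symmetric monoidal structures `M c`, `S c` on the four categories, with the universal
    -- bilinear functions `p c` and the elements `e c` of their units
    ∃ (M : ∀ c : SigmaKind, MonoidalCategory (SCat.{u} c))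
      (S : ∀ c : SigmaKind, SymmetricCategory (SCat.{u} c))
      (p : ∀ (c : SigmaKind) (X Y : SCat.{u} c), SCat.El X → SCat.El Y → SCat.El (X ⊗ Y))
      (e : ∀ c : SigmaKind, SCat.El (𝟙_ (SCat.{u} c))),
      -- the monoidal product is the tensor product
      (∀ c, SCat.IsTensorMonoidal (p c) (e c)) ∧
      -- they are closed
      (∀ c, Nonempty (MonoidalClosed (SCat.{u} c))) ∧
      -- the unit of the category of weak `Σ`-monoids is `{0, 1}`
      (∃ i : 𝟙_ (SCat.{u} .weak) ≅ SCat.unit.{u}, SCat.fn i.hom (e .weak) = ULift.up 1) ∧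
      -- for each reflector `F`, `X ⊗' Y` is `F (U X ⊗ U Y)` and the unit is `F I`
      (∀ (c : SigmaKind) (F : SCat.{u} .weak ⥤ SCat.{u} c) (adj : F ⊣ SCat.toWeak c),
        (∀ X Y : SCat.{u} c,
          ∃ i : X ⊗ Y ≅ F.obj ((SCat.toWeak c).obj X ⊗ (SCat.toWeak c).obj Y),
            ∀ (x : SCat.El X) (y : SCat.El Y), SCat.fn i.hom (p c X Y x y) =
              SCat.unitFn adj _ (p .weak ((SCat.toWeak c).obj X) ((SCat.toWeak c).obj Y) x y)) ∧
        ∃ i : 𝟙_ (SCat.{u} c) ≅ F.obj SCat.unit.{u},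
          SCat.fn i.hom (e c) = SCat.unitFn adj SCat.unit.{u} (ULift.up 1)) ∧
      -- every left adjoint of an embedding is strong symmetric monoidal, through the canonical
      -- isomorphisms `F X ⊗ F Y ≅ F (X ⊗ Y)`
      (∀ (c d : SigmaKind) (h : SigmaKind.prop.{u} c ≤ SigmaKind.prop.{u} d)
        (F : SCat.{u} d ⥤ SCat.{u} c) (adj : F ⊣ SCat.emb h),
        ∃ _ : F.Braided,
          SCat.fn (Functor.LaxMonoidal.ε F) (e c) = SCat.unitFn adj (𝟙_ (SCat.{u} d)) (e d) ∧
          ∀ (X Y : SCat.{u} d) (x : SCat.El X) (y : SCat.El Y),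
            SCat.fn (Functor.LaxMonoidal.μ F X Y)
                (p c (F.obj X) (F.obj Y) (SCat.unitFn adj X x) (SCat.unitFn adj Y y)) =
              SCat.unitFn adj (X ⊗ Y) (p d X Y x y)) := 
  ⟨fun _ _ => SCat.emb_isRightAdjoint, SCat.monoidal, SCat.symmetric, fun _ => SCat.tmul,
    SCat.unitEl, SCat.isTensorMonoidal, SCat.nonempty_monoidalClosed, SCat.exists_unit_iso,
    fun _ _ adj => ⟨SCat.exists_tensor_iso_reflect adj, SCat.exists_unit_iso_reflect adj⟩,
    fun _ _ _ _ adj => SCat.exists_braided adj⟩
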